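/- Let $n\ge 0$, let $S\subseteq\mathbb{R}^n$ be a convex set, and consider the structure $\mathbb{A}_S=(\mathbb{R};+,\ (x\mapsto x\cdot c)_{c\in\mathbb{R}},\ (c)_{c\in\mathbb{R}},\ S)$ with addition, multiplication by each real scalar, a constant for every real number, and the $n$-ary relation $S$. Infinitary primitive positive (pp) formulas over $\mathbb{A}_S$ are the members of the smallest class of formulas that contains true, false and all atomic formulas (equalities of terms, and $S$ applied to terms), and that is closed under substitution of variables, under conjunctions of arbitrary (finite or infinite) families having only finitely many free variables in total, and under existential quantification $\exists x$ over a single variable. A set $T\subseteq\mathbb{R}^m$ is infinitary pp-definable in $\mathbb{A}_S$ if some infinitary pp formula with free variables among $x_1,\dots,x_m$ defines it. A polymorphism of $\mathbb{A}_S$ of arity $\alpha$ is a map $f\colon\mathbb{R}^\alpha\to\mathbb{R}$ which commutes with addition, with all scalar multiplications and with all constants (that is, $f(x+y)=f(x)+f(y)$, $f(c x)=c f(x)$, and $f((c)_{i\in\alpha})=c$ for all $c\in\mathbb{R}$) and which preserves $S$; here $f$ preserves $T\subseteq\mathbb{R}^m$ if, for every family $(t^i)_{i\in\alpha}$ of elements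 of $T$, the point $\bigl(f((t^i_1)_{i\in\alpha}),\dots,f((t^i_m)_{i\in\alpha})\bigr)$ lies in $T$. Then for every $m\ge 0$ and every set $T\subseteq\mathbb{R}^m$, the following are equivalent: 1. $T$ is infinitary pp-definable in $\mathbb{A}_S$; 2. $T$ is preserved by every polymorphism of $\mathbb{A}_S$ of countable (finite or countably infinite) arity. -/

import Mathlib

namespace InfPP

universe u v w

/-- Infinitary primitive positive formulas over a signature `L` whose free variables are among
`x₀, …, x_{n-1}`: the smallest class that contains true, false and the atomic formulas (equalities
of terms, and relation symbols applied to terms), and that is closed under substitution of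
variables, conjunctions of arbitrary families (with finitely many free variables in total),
and existential quantification over one variable (the last one of `n + 1`). -/
inductive IPPFormula (L : FirstOrder.Language.{u, v}) : ℕ → Type (max u v 1)
  | verum {n : ℕ} : IPPFormula L n
  | falsum {n : ℕ} : IPPFormula L n
  | equal {n : ℕ} (t₁ t₂ : L.Term (Fin n)) : IPPFormula L n
  | rel {n k : ℕ} (R : L.Relations k) (t : Fin k → L.Term (Fin n)) : IPPFormula L n
  | subst {k n : ℕ} (σ : Fin k → Fin n) (φ : IPPFormula L k) : IPPFormula L n
  | conj {n : ℕ} {I : Type} (φ : I → IPPFormula L n) : IPPFormula L n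
  | ex {n : ℕ} (φ : IPPFormula L (n + 1)) : IPPFormula L n

/-- Satisfaction of an infinitary primitive positive formula in an `L`-structure `A`. -/
def IPPFormula.Realize {L : FirstOrder.Language.{u, v}} {A : Type w} [L.Structure A] :
    {n : ℕ} → IPPFormula L n → (Fin n → A) → Prop
  | _, .verum, _ => True
  | _, .falsum, _ => False
  | _, .equal t₁ t₂, x => t₁.realize x = t₂.realize x
  | _, .rel R t, x => FirstOrder.Language.Structure.RelMap R (fun j => (t j).realize x)
  | _, .subst σ φ, x => φ.Realize (fun j => x (σ j))
  | _, .conj φ, x => ∀ i, (φ i).Realize x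
  | _, .ex φ, x => ∃ a : A, φ.Realize (Fin.snoc x a)

/-- `T ⊆ Aⁿ` is infinitary pp-definable in the `L`-structure `A`. -/
def IsInfPPDefinable (L : FirstOrder.Language.{u, v}) {A : Type w} [L.Structure A] {n : ℕ}
    (T : Set (Fin n → A)) : Prop :=
  ∃ φ : IPPFormula L n, ∀ x : Fin n → A, x ∈ T ↔ φ.Realize x

/-- The map `f : A^ι → A`, applied coordinatewise to an `ι`-indexed family of `m`-tuples. -/
def applyCoord {A : Type w} {ι : Type*} (f : (ι → A) → A) {m : ℕ} (x : ι → Fin m → A) :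
    Fin m → A :=
  fun j => f (fun i => x i j)

/-- `f : A^ι → A` preserves the relation `T ⊆ A^m` (equivalently, `T` is invariant under `f`). -/
def Preserves {A : Type w} {ι : Type*} (f : (ι → A) → A) {m : ℕ} (T : Set (Fin m → A)) : Prop :=
  ∀ x : ι → Fin m → A, (∀ i, x i ∈ T) → applyCoord f x ∈ T

/-- Polymorphisms of an `L`-structure `A`, with arity given by the index type `ι`: maps
`A^ι → A` that preserve all relations and commute with all functions of the structure
(constants being functions of arity `0`). -/
structure IsPolymorphism (L : FirstOrder.Language.{u, v}) {A : Type w} [L.Structure A] {ι : Type*}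
    (f : (ι → A) → A) : Prop where
  map_rel : ∀ {m : ℕ} (R : L.Relations m),
    Preserves f {a : Fin m → A | FirstOrder.Language.Structure.RelMap R a}
  map_fun : ∀ {m : ℕ} (g : L.Functions m) (x : ι → Fin m → A),
    FirstOrder.Language.Structure.funMap g (applyCoord f x) =
      f (fun i => FirstOrder.Language.Structure.funMap g (x i))

/-- Function symbols `+`, `· c` for `c ∈ ℝ`, and constants `c ∈ ℝ`. -/
inductive RealFunc : ℕ → Type
  | add : RealFunc 2
  | mulConst (c : ℝ) : RealFunc 1
  | const (c : ℝ) : RealFunc 0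

/-- A single relation symbol, of arity `n`, naming the relation `S ⊆ ℝⁿ`. -/
inductive RealRel {n : ℕ} (S : Set (Fin n → ℝ)) : ℕ → Type
  | sym : RealRel S n

/-- The signature `(+, · c | c ∈ ℝ, c | c ∈ ℝ, S)`. -/
def realLang {n : ℕ} (S : Set (Fin n → ℝ)) : FirstOrder.Language.{0, 0} where
  Functions := RealFunc
  Relations := RealRel S

/-- The structure `(ℝ; +, · c | c ∈ ℝ, c | c ∈ ℝ, S)`. -/
instance realStructure {n : ℕ} (S : Set (Fin n → ℝ)) : (realLang S).Structure ℝ where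
  funMap {k} (g : RealFunc k) :=
    match k, g with
    | _, .add => fun x => x 0 + x 1
    | _, .mulConst c => fun x => x 0 * c
    | _, .const c => fun _ => c
  RelMap {k} (R : RealRel S k) :=
    match k, R with
    | _, .sym => fun x => x ∈ S

end InfPP

/-! A polymorphism preserves whatever a formula defines, by induction on the formula. For the
converse, consider classes of relations closed under intersections, affine preimages and projections
(`PPClass`). The definable relations (`defClass`) and the relations invariant under a linear
functional fixing constants (`invClass`) are both such classes, so a construction valid in all
classes (`Yields`) serves definability and invariance at once.

Up to mutual yielding there are only six nonempty convex sets: `univ`, `Icc 0 1`, `Ioo 0 1`,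
`pinchedSquare`, `pinchedStrip`, `Ici 0`, each yielding its predecessors. The core is a dichotomy
for neighbours `R`, `R'` in this chain: a convex set that does not yield `R'` is yielded by `R`. To
prove it, the set is cut out by sets each omitting one outside point, with induction on dimension
(`PPClass.Mem_of_glue`); failing to yield `R'` supplies the boundedness or regularity of faces that
this needs.

Neighbours are `Separated`: some functional of countable arity preserves `R` but not `R'`. If `S`
yields `R` but not `R'`, this functional preserves `S`, so it is a polymorphism and preserves `T`.
Hence `T` cannot yield `R'`, and `S` yields `R`, which yields `T`. At the top of the chain `Ici 0`
yields every convex set; `T` is convex because binary convex combinations are polymorphisms. -/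

namespace InfPP

open FirstOrder

/-! ### Substitution into formulas and preservation by polymorphisms. -/

section Formulas

universe u v w

variable {L : FirstOrder.Language.{u, v}} {A : Type w} [L.Structure A]

/-- Substituting terms for the variables of an infinitary pp formula yields a definable set. -/
theorem exists_realize_subst_terms {l : ℕ} (φ : IPPFormula L l) :
    ∀ {k : ℕ} (σ : Fin l → L.Term (Fin k)),
      ∃ ψ : IPPFormula L k, ∀ x : Fin k → A,
        ψ.Realize x ↔ φ.Realize (fun j => (σ j).realize x) := by
  induction φ with
  | verum => exact fun σ => ⟨.verum, fun x => Iff.rfl⟩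
  | falsum => exact fun σ => ⟨.falsum, fun x => Iff.rfl⟩
  | equal t₁ t₂ =>
    exact fun σ => ⟨.equal (t₁.subst σ) (t₂.subst σ), fun x => by
      simp [IPPFormula.Realize, Language.Term.realize_subst]⟩
  | rel R t =>
    exact fun σ => ⟨.rel R (fun j => (t j).subst σ), fun x => by
      simp [IPPFormula.Realize, Language.Term.realize_subst]⟩
  | subst τ φ ih =>
    intro k σ
    obtain ⟨ψ, hψ⟩ := ih (fun j => σ (τ j))
    exact ⟨ψ, fun x => by rw [hψ]; rfl⟩
  | conj φ ih =>
    intro k σ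
    choose ψ hψ using fun i => ih i σ
    exact ⟨.conj ψ, fun x => by simp only [IPPFormula.Realize, hψ]⟩
  | @ex n φ ih =>
    intro k σ
    obtain ⟨ψ, hψ⟩ := ih (Fin.snoc (α := fun _ => L.Term (Fin (k + 1)))
      (fun j => (σ j).relabel Fin.castSucc) (Language.var (Fin.last k)))
    refine ⟨.ex ψ, fun x => exists_congr fun a => ?_⟩
    rw [hψ]
    apply iff_of_eq
    congr 1
    funext j
    refine Fin.lastCases ?_ (fun j => ?_) j
    · simp
    · simp only [Fin.snoc_castSucc, Language.Term.realize_relabel]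
      congr 1
      funext i
      simp

theorem realize_applyCoord {ι : Type*} {f : (ι → A) → A} (hf : IsPolymorphism L f) {n : ℕ}
    (t : L.Term (Fin n)) (x : ι → Fin n → A) :
    t.realize (applyCoord f x) = f (fun i => t.realize (x i)) := by
  induction t with
  | var j => rfl
  | func g ts ih =>
    simp only [Language.Term.realize]
    rw [← hf.map_fun g (fun i j => (ts j).realize (x i))]
    congr 1
    funext j
    exact ih j

/-- Polymorphisms of nonzero arity preserve infinitary pp formulas. -/
theorem IPPFormula.realize_applyCoord {ι : Type*} [Nonempty ι] {f : (ι → A) → A}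
    (hf : IsPolymorphism L f) {n : ℕ} (φ : IPPFormula L n) :
    ∀ x : ι → Fin n → A, (∀ i, φ.Realize (x i)) → φ.Realize (applyCoord f x) := by
  induction φ with
  | verum => exact fun _ _ => trivial
  | falsum => exact fun x h => h (Classical.arbitrary ι)
  | equal t₁ t₂ =>
    intro x h
    simp only [IPPFormula.Realize, InfPP.realize_applyCoord hf] at h ⊢
    exact congrArg f (funext h)
  | rel R t =>
    intro x h
    simp only [IPPFormula.Realize, InfPP.realize_applyCoord hf] at h ⊢
    exact hf.map_rel R (fun i j => (t j).realize (x i)) h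
  | subst τ φ ih => exact fun x h => ih (fun i j => x i (τ j)) h
  | conj φ ih => exact fun x h i => ih i x fun j => h j i
  | ex φ ih =>
    intro x h
    choose a ha using h
    refine ⟨f a, ?_⟩
    have := ih (fun i => Fin.snoc (x i) (a i)) ha
    convert this using 1
    funext j
    refine Fin.lastCases ?_ (fun j => ?_) j <;> simp [applyCoord]

end Formulas

/-! ### Classes closed under pp constructions. -/

/-- A family of subsets of the spaces `ℝᵏ` closed under the operations that infinitary pp
definitions over a reduct containing the affine structure of `ℝ` allow. -/
structure PPClass where
  mem : ∀ {k : ℕ}, Set (Fin k → ℝ) → Prop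
  mem_empty : ∀ {k : ℕ}, mem (∅ : Set (Fin k → ℝ))
  mem_iInter : ∀ {k : ℕ} {I : Type} {s : I → Set (Fin k → ℝ)}, (∀ i, mem (s i)) → mem (⋂ i, s i)
  mem_preimage : ∀ {k l : ℕ} {s : Set (Fin l → ℝ)} (g : (Fin k → ℝ) →ₗ[ℝ] (Fin l → ℝ))
    (e : Fin l → ℝ), mem s → mem {u | g u + e ∈ s}
  mem_proj : ∀ {k : ℕ} {s : Set (Fin (k + 1) → ℝ)}, mem s →
    mem {x : Fin k → ℝ | ∃ a : ℝ, (Fin.snoc x a : Fin (k + 1) → ℝ) ∈ s}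
  mem_zero : mem ({0} : Set (Fin 1 → ℝ))

theorem exists_term_realize_eq {n : ℕ} (S : Set (Fin n → ℝ)) {k : ℕ}
    (g : (Fin k → ℝ) →ₗ[ℝ] ℝ) (e : ℝ) :
    ∃ t : (realLang S).Term (Fin k), ∀ x : Fin k → ℝ, t.realize x = g x + e := by
  have key : ∀ s : Finset (Fin k), ∃ t : (realLang S).Term (Fin k), ∀ x : Fin k → ℝ,
      t.realize x = ∑ i ∈ s, x i * g (Pi.single i 1) + e := by
    intro s
    induction s using Finset.induction_on with
    | empty =>
      refine ⟨Language.Term.func (L := realLang S) (RealFunc.const e) Fin.elim0, fun x => ?_⟩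
      simp only [Finset.sum_empty, zero_add]
      rfl
    | insert i s hi ih =>
      obtain ⟨t, ht⟩ := ih
      refine ⟨Language.Term.func (L := realLang S) RealFunc.add
        ![Language.Term.func (L := realLang S) (RealFunc.mulConst (g (Pi.single i 1)))
          ![Language.var i], t], fun x => ?_⟩
      rw [Finset.sum_insert hi, add_assoc, ← ht x]
      rfl
  obtain ⟨t, ht⟩ := key Finset.univ
  refine ⟨t, fun x => ?_⟩
  rw [ht, LinearMap.pi_apply_eq_sum_univ g x]
  simp only [smul_eq_mul]
  congr 2
  funext i
  congr 2
  funext j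
  simp [Pi.single_apply, eq_comm]

/-- The infinitary pp-definable relations. -/
def defClass {n : ℕ} (S : Set (Fin n → ℝ)) : PPClass where
  mem := fun T => IsInfPPDefinable (realLang S) T
  mem_empty := ⟨.falsum, fun _ => Iff.rfl⟩
  mem_iInter := by
    intro k I s h
    choose φ hφ using h
    exact ⟨.conj φ, fun x => by simp [IPPFormula.Realize, hφ]⟩
  mem_preimage := by
    rintro k l s g e ⟨φ, hφ⟩
    choose t ht using fun j => exists_term_realize_eq S (LinearMap.proj j ∘ₗ g) (e j)
    obtain ⟨ψ, hψ⟩ := exists_realize_subst_terms (A := ℝ) φ t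
    refine ⟨ψ, fun x => ?_⟩
    rw [hψ, Set.mem_ofPred_eq, hφ]
    simp only [ht]
    rfl
  mem_proj := by
    rintro k s ⟨φ, hφ⟩
    exact ⟨.ex φ, fun x => exists_congr fun a => hφ _⟩
  mem_zero := by
    obtain ⟨t, ht⟩ := exists_term_realize_eq S (LinearMap.proj (0 : Fin 1)) 0
    obtain ⟨t', ht'⟩ := exists_term_realize_eq S (0 : (Fin 1 → ℝ) →ₗ[ℝ] ℝ) 0
    refine ⟨.equal t t', fun x => ?_⟩
    simp only [IPPFormula.Realize, ht, ht', Set.mem_singleton_iff, funext_iff]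
    simp

/-- The family on the right is a finite combination of coordinate families plus `e` times the
constant family 1, which is why `f` must fix 1. -/
theorem linearMap_applyCoord {ι : Type*} (f : (ι → ℝ) →ₗ[ℝ] ℝ) (hf : f (fun _ => 1) = 1) {k : ℕ}
    (g : (Fin k → ℝ) →ₗ[ℝ] ℝ) (e : ℝ) (x : ι → Fin k → ℝ) :
    g (applyCoord f x) + e = f (fun i => g (x i) + e) := by
  have h1 : (fun i => g (x i) + e) =
      ∑ j : Fin k, g (fun j' => if j = j' then 1 else 0) • (fun i => x i j)
        + e • (fun _ : ι => (1 : ℝ)) := by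
    funext i
    rw [LinearMap.pi_apply_eq_sum_univ g (x i)]
    simp [Finset.sum_apply, mul_comm]
  rw [h1, map_add, map_sum, map_smul, hf, LinearMap.pi_apply_eq_sum_univ g]
  simp [applyCoord, mul_comm]

/-- The relations invariant under a linear functional fixing the constants. -/
def invClass {ι : Type*} (f : (ι → ℝ) →ₗ[ℝ] ℝ) (hf : f (fun _ => 1) = 1) : PPClass where
  mem := fun T => Preserves f T
  mem_empty := by
    intro k x hx
    cases isEmpty_or_nonempty ι with
    | inl h =>
      have : (fun _ : ι => (1 : ℝ)) = 0 := Subsingleton.elim _ _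
      rw [this, map_zero] at hf
      exact absurd hf zero_ne_one
    | inr h => exact hx (Classical.arbitrary ι)
  mem_iInter := by
    intro k I s h x hx
    simp only [Set.mem_iInter] at hx ⊢
    exact fun j => h j x fun i => hx i j
  mem_preimage := by
    intro k l s g e h x hx
    have := h (fun i => g (x i) + e) hx
    rw [Set.mem_ofPred_eq]
    convert this using 1
    funext j
    exact linearMap_applyCoord f hf (LinearMap.proj j ∘ₗ g) (e j) x
  mem_proj := by
    intro k s h x hx
    choose a ha using hx
    refine ⟨f a, ?_⟩
    convert h _ ha using 1
    funext j
    refine Fin.lastCases ?_ (fun j => ?_) j <;> simp [applyCoord]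
  mem_zero := by
    intro x hx
    have : x = 0 := funext hx
    subst this
    funext j
    exact map_zero f

theorem isPolymorphism_of_linearMap {n : ℕ} {S : Set (Fin n → ℝ)} {ι : Type*}
    (f : (ι → ℝ) →ₗ[ℝ] ℝ) (hf : f (fun _ => 1) = 1) (h : Preserves f S) :
    IsPolymorphism (realLang S) f where
  map_rel := by
    intro m R
    cases R
    exact h
  map_fun := by
    intro m g x
    cases g with
    | add => exact (map_add f (fun i => x i 0) (fun i => x i 1)).symm
    | mulConst c =>
      have := map_smul f c (fun i => x i 0)
      rw [smul_eq_mul, mul_comm] at this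
      refine this.symm.trans (congrArg f (funext fun i => ?_))
      exact mul_comm _ _
    | const c =>
      have := map_smul f c (fun _ => 1)
      rw [hf, smul_eq_mul, mul_one] at this
      refine this.symm.trans (congrArg f (funext fun i => ?_))
      exact mul_one _

/-- In arity zero all argument families coincide, so commuting with the constants 0 and 1 would give
`0 = 1`. -/
theorem nonempty_of_isPolymorphism {n : ℕ} {S : Set (Fin n → ℝ)} {ι : Type*} {f : (ι → ℝ) → ℝ}
    (hf : IsPolymorphism (realLang S) f) : Nonempty ι := by
  by_contra h
  rw [not_nonempty_iff] at h
  have h0 : (0 : ℝ) = f _ := hf.map_fun (RealFunc.const 0) (fun _ => Fin.elim0)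
  have h1 : (1 : ℝ) = f _ := hf.map_fun (RealFunc.const 1) (fun _ => Fin.elim0)
  refine zero_ne_one (h0.trans (Eq.trans (congrArg f ?_) h1.symm))
  exact Subsingleton.elim _ _

theorem IsInfPPDefinable.preserves {n : ℕ} {S : Set (Fin n → ℝ)} {m : ℕ} {T : Set (Fin m → ℝ)}
    (hT : IsInfPPDefinable (realLang S) T) {ι : Type*} {f : (ι → ℝ) → ℝ}
    (hf : IsPolymorphism (realLang S) f) : Preserves f T := by
  obtain ⟨φ, hφ⟩ := hT
  have := nonempty_of_isPolymorphism hf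
  intro x hx
  rw [hφ]
  exact φ.realize_applyCoord hf x fun i => (hφ _).1 (hx i)

theorem defClass_mem_self {n : ℕ} (S : Set (Fin n → ℝ)) : (defClass S).mem S :=
  ⟨.rel (L := realLang S) RealRel.sym Language.var, fun _ => Iff.rfl⟩

/-! ### Membership in a class for subsets of arbitrary vector spaces. -/

namespace PPClass

variable (C : PPClass) {E F : Type*} [AddCommGroup E] [Module ℝ E] [AddCommGroup F] [Module ℝ F]

/-- Membership in the class for subsets of an arbitrary real vector space: all preimages under
affine maps from the spaces `ℝᵏ` lie in the class. -/
def Mem (s : Set E) : Prop :=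
  ∀ (k : ℕ) (g : (Fin k → ℝ) →ₗ[ℝ] E) (e : E), C.mem {u | g u + e ∈ s}

variable {C}

theorem Mem_iff_mem {k : ℕ} {s : Set (Fin k → ℝ)} : C.Mem s ↔ C.mem s :=
  ⟨fun h => by simpa using h k LinearMap.id 0, fun h _ g e => C.mem_preimage g e h⟩

theorem Mem_empty : C.Mem (∅ : Set E) := fun _ _ _ => C.mem_empty

theorem Mem.preimage {s : Set F} (h : C.Mem s) (g : E →ₗ[ℝ] F) (c : F) :
    C.Mem {x | g x + c ∈ s} := fun k g' e => by
  simpa [add_assoc] using h k (g ∘ₗ g') (g e + c)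

/-- Preimages under maps that are visibly affine. -/
theorem Mem.of_affine {s : Set F} (h : C.Mem s) {t : Set E} (g : E →ₗ[ℝ] F) (c : F)
    (ht : ∀ x, x ∈ t ↔ g x + c ∈ s) : C.Mem t := by
  have := h.preimage g c
  convert this using 1
  ext x
  exact ht x

theorem Mem_iInter {I : Type} {s : I → Set E} (h : ∀ i, C.Mem (s i)) : C.Mem (⋂ i, s i) := by
  intro k g e
  have := C.mem_iInter fun i => h i k g e
  convert this using 1
  ext u
  simp

theorem Mem_forall {I : Type} {s : I → E → Prop} (h : ∀ i, C.Mem {x | s i x}) :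
    C.Mem {x | ∀ i, s i x} := by
  rw [Set.ofPred_forall]
  exact Mem_iInter h

theorem Mem_univ : C.Mem (Set.univ : Set E) := by
  have := Mem_iInter (C := C) (I := Empty) (s := fun _ => (∅ : Set E)) (fun i => i.elim)
  simpa using this

theorem Mem.and {p q : E → Prop} (hp : C.Mem {x | p x}) (hq : C.Mem {x | q x}) :
    C.Mem {x | p x ∧ q x} := by
  have : C.Mem {x | ∀ b : Bool, bif b then p x else q x} :=
    Mem_forall fun b => by cases b <;> assumption
  simpa [and_comm] using this

theorem Mem.exists_real {s : Set (E × ℝ)} (h : C.Mem s) : C.Mem {x | ∃ a : ℝ, (x, a) ∈ s} := by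
  intro k g e
  let pr : (Fin (k + 1) → ℝ) →ₗ[ℝ] (Fin k → ℝ) := LinearMap.funLeft ℝ ℝ Fin.castSucc
  have := C.mem_proj (h (k + 1)
    ((g ∘ₗ pr).prod (LinearMap.proj (Fin.last k) : (Fin (k + 1) → ℝ) →ₗ[ℝ] ℝ)) (e, 0))
  convert this using 1
  ext x
  have : ∀ a : ℝ, pr (Fin.snoc (α := fun _ => ℝ) x a) = x := fun a => by
    funext i
    simp [pr, LinearMap.funLeft]
  simp [this]

theorem Mem.exists_pi {l : ℕ} : ∀ {E : Type _} [AddCommGroup E] [Module ℝ E]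
    {s : Set (E × (Fin l → ℝ))}, C.Mem s → C.Mem {x | ∃ y, (x, y) ∈ s} := by
  induction l with
  | zero =>
    intro E _ _ s h
    refine h.of_affine (LinearMap.inl ℝ E (Fin 0 → ℝ)) 0 fun x => ?_
    constructor
    · rintro ⟨y, hy⟩
      rw [Subsingleton.elim y 0] at hy
      simpa using hy
    · exact fun hx => ⟨0, by simpa using hx⟩
  | succ l ih =>
    intro E _ _ s h
    let c : (ℝ × (Fin l → ℝ)) →ₗ[ℝ] (Fin (l + 1) → ℝ) :=
      (Fin.consLinearEquiv ℝ (fun _ => ℝ)).toLinearMap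
    have h1 : C.Mem {z : (E × ℝ) × (Fin l → ℝ) | (z.1.1, c (z.1.2, z.2)) ∈ s} := by
      refine h.of_affine (((LinearMap.fst ℝ E ℝ) ∘ₗ LinearMap.fst ℝ (E × ℝ) (Fin l → ℝ)).prod
        (c ∘ₗ (((LinearMap.snd ℝ E ℝ) ∘ₗ LinearMap.fst ℝ (E × ℝ) (Fin l → ℝ)).prod
          (LinearMap.snd ℝ (E × ℝ) (Fin l → ℝ))))) 0 fun x => ?_
      simp
    have h2 := (ih h1).exists_real
    convert h2 using 1
    ext x
    constructor
    · rintro ⟨y, hy⟩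
      refine ⟨y 0, Fin.tail y, ?_⟩
      have : c (y 0, Fin.tail y) = y := Fin.cons_self_tail y
      rw [Set.mem_ofPred_eq, this]
      exact hy
    · rintro ⟨a, y, hy⟩
      exact ⟨_, hy⟩

theorem Mem.exists [FiniteDimensional ℝ F] {s : Set (E × F)} (h : C.Mem s) :
    C.Mem {x | ∃ y, (x, y) ∈ s} := by
  let b := (Module.finBasis ℝ F).equivFun
  have h1 : C.Mem {z : E × (Fin (Module.finrank ℝ F) → ℝ) | (z.1, b.symm z.2) ∈ s} := by
    refine h.of_affine ((LinearMap.fst ℝ _ _).prod (b.symm.toLinearMap ∘ₗ LinearMap.snd ℝ _ _)) 0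
      fun x => ?_
    simp
  have h2 := h1.exists_pi
  convert h2 using 1
  ext x
  constructor
  · rintro ⟨y, hy⟩
    exact ⟨b y, by simpa using hy⟩
  · rintro ⟨y, hy⟩
    exact ⟨_, hy⟩

theorem Mem_zero_real : C.Mem ({0} : Set ℝ) := by
  refine (Mem_iff_mem.2 C.mem_zero).of_affine (LinearMap.pi fun _ => LinearMap.id) 0 fun x => ?_
  simp [funext_iff]

theorem Mem_zero [FiniteDimensional ℝ E] : C.Mem ({0} : Set E) := by
  let b := (Module.finBasis ℝ E)
  have : C.Mem {x : E | ∀ i, b.coord i x = 0} :=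
    Mem_forall fun i => Mem_zero_real.of_affine (b.coord i) 0 fun x => by simp
  convert this using 1
  ext x
  exact (b.forall_coord_eq_zero_iff).symm

theorem Mem.image [FiniteDimensional ℝ E] [FiniteDimensional ℝ F] {s : Set E} (h : C.Mem s)
    (g : E →ₗ[ℝ] F) (c : F) : C.Mem {y | ∃ x ∈ s, g x + c = y} := by
  have h1 : C.Mem {z : F × E | z.2 ∈ s} :=
    h.of_affine (LinearMap.snd ℝ _ _) 0 fun x => by simp
  have h2 : C.Mem {z : F × E | g z.2 + c = z.1} :=
    Mem_zero.of_affine (g ∘ₗ LinearMap.snd ℝ _ _ - LinearMap.fst ℝ _ _) c fun x => by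
      simp only [Set.mem_ofPred_eq, Set.mem_singleton_iff, LinearMap.sub_apply,
        LinearMap.comp_apply, LinearMap.snd_apply, LinearMap.fst_apply]
      rw [sub_add_eq_add_sub, sub_eq_zero]
  exact (h1.and h2).exists

end PPClass

/-- `s` yields `t` if `t` lies in every class containing `s`. -/
def Yields {E F : Type*} [AddCommGroup E] [Module ℝ E] [AddCommGroup F] [Module ℝ F]
    (s : Set E) (t : Set F) : Prop :=
  ∀ C : PPClass, C.Mem s → C.Mem t

theorem Yields.trans {E F G : Type*} [AddCommGroup E] [Module ℝ E] [AddCommGroup F] [Module ℝ F]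
    [AddCommGroup G] [Module ℝ G] {s : Set E} {t : Set F} {r : Set G}
    (h : Yields s t) (h' : Yields t r) : Yields s r := fun C hC => h' C (h C hC)

end InfPP

/-! ### The reference sets and the constructions between them. -/

namespace InfPP

open Set

/-- A closed rectangle with all but one point of one side removed. -/
def pinchedSquare : Set (ℝ × ℝ) := {z | 0 ≤ z.2 ∧ z.2 ≤ 1 ∧ |z.1| ≤ 1 ∧ (z.2 = 0 → z.1 = 0)}

/-- A strip with all but one point of one boundary line removed. -/
def pinchedStrip : Set (ℝ × ℝ) := {z | 0 ≤ z.2 ∧ z.2 ≤ 1 ∧ (z.2 = 0 → z.1 = 0)}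

/-- An open half plane together with one boundary point. -/
def pinchedHalfPlane : Set (ℝ × ℝ) := {z | 0 ≤ z.2 ∧ (z.2 = 0 → z.1 = 0)}

namespace PPClass

variable {C : PPClass} {E F : Type*} [AddCommGroup E] [Module ℝ E] [AddCommGroup F] [Module ℝ F]

/-- Preimages under affine functionals. -/
theorem Mem.functional {J : Set ℝ} (h : C.Mem J) (l : E →ₗ[ℝ] ℝ) (c : ℝ) :
    C.Mem {x | l x + c ∈ J} := h.preimage l c

theorem Mem.rescale {J : Set ℝ} (h : C.Mem J) (α β : ℝ) : C.Mem {s : ℝ | α * s + β ∈ J} :=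
  h.of_affine (α • LinearMap.id) β fun x => by simp

theorem Mem.line {T : Set E} (h : C.Mem T) (x v : E) : C.Mem {s : ℝ | x + s • v ∈ T} :=
  h.of_affine (LinearMap.toSpanSingleton ℝ E v) x fun s => by simp [add_comm]

theorem Mem_Icc (h : C.Mem (Icc (0 : ℝ) 1)) {c d : ℝ} (hcd : c < d) : C.Mem (Icc c d) := by
  convert h.rescale (d - c)⁻¹ (-(d - c)⁻¹ * c) using 1
  have hpos := sub_pos.2 hcd
  ext x
  have : (d - c)⁻¹ * x + -(d - c)⁻¹ * c = (x - c) / (d - c) := by ring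
  simp only [mem_Icc, mem_ofPred_eq, this, le_div_iff₀ hpos, div_le_iff₀ hpos]
  constructor <;> rintro ⟨h1, h2⟩ <;> constructor <;> linarith

theorem Mem_Ioo (h : C.Mem (Ioo (0 : ℝ) 1)) {c d : ℝ} (hcd : c < d) : C.Mem (Ioo c d) := by
  convert h.rescale (d - c)⁻¹ (-(d - c)⁻¹ * c) using 1
  have hpos := sub_pos.2 hcd
  ext x
  have : (d - c)⁻¹ * x + -(d - c)⁻¹ * c = (x - c) / (d - c) := by ring
  simp only [mem_Ioo, mem_ofPred_eq, this, lt_div_iff₀ hpos, div_lt_iff₀ hpos]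
  constructor <;> rintro ⟨h1, h2⟩ <;> constructor <;> linarith

end PPClass

open PPClass

section

variable {E F : Type*} [AddCommGroup E] [Module ℝ E] [AddCommGroup F] [Module ℝ F]

theorem yields_image [FiniteDimensional ℝ E] [FiniteDimensional ℝ F] (T : Set E) (g : E →ₗ[ℝ] F) :
    Yields T (g '' T) := fun C h => by
  convert h.image g 0 using 1
  ext y
  simp

end

theorem mem_of_mem_of_le {J : Set ℝ} (hJ : Convex ℝ J) {a b x : ℝ} (ha : a ∈ J) (hb : b ∈ J)
    (h1 : a ≤ x) (h2 : x ≤ b) : x ∈ J := hJ.ordConnected.out ha hb ⟨h1, h2⟩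

/-- Powers of `x` stretch the segment between `a` and `b` beyond `c`, so some `α * x ^ k + β` leaves
`J`. At an exponent where the sequence has just left `J`, absorbing the preceding power into `α`
gives the claim. -/
theorem exists_affine_notMem {J : Set ℝ} (hJ : Convex ℝ J) {a b c : ℝ} (ha : a ∈ J) (hb : b ∈ J)
    (hab : a ≠ b) (hc : c ∉ J) {x : ℝ} (hx : 1 < x) :
    ∃ α β : ℝ, β ∈ J ∧ α + β ∈ J ∧ α * x + β ∉ J := by
  have key : ∃ α β : ℝ, ∃ k : ℕ, β ∈ J ∧ α + β ∈ J ∧ α * x ^ k + β ∉ J := by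
    rcases lt_or_gt_of_ne (show a ≠ c by rintro rfl; exact hc ha) with h | h
    · wlog hab' : a < b generalizing a b
      · have hba : b < a := lt_of_le_of_ne (not_lt.1 hab') hab.symm
        have hbc : b < c := hba.trans h
        exact this hb ha hab.symm hbc hba
      obtain ⟨k, hk⟩ := pow_unbounded_of_one_lt ((c - a) / (b - a)) hx
      rw [div_lt_iff₀ (sub_pos.2 hab')] at hk
      exact ⟨b - a, a, k, ha, by simpa using hb, fun h' =>
        hc (mem_of_mem_of_le hJ ha h' h.le (by linarith))⟩
    · wlog hab' : b < a generalizing a b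
      · have hba : a < b := lt_of_le_of_ne (not_lt.1 hab') hab
        exact this hb ha hab.symm (h.trans hba) hba
      obtain ⟨k, hk⟩ := pow_unbounded_of_one_lt ((a - c) / (a - b)) hx
      rw [div_lt_iff₀ (sub_pos.2 hab')] at hk
      exact ⟨b - a, a, k, ha, by simpa using hb, fun h' =>
        hc (mem_of_mem_of_le hJ h' ha (by linarith) h.le)⟩
  obtain ⟨α, β, k, h1, h2, h3⟩ := key
  induction k with
  | zero => exact absurd (by simpa using h2) h3
  | succ k ih =>
    by_cases h : α * x ^ k + β ∈ J
    · exact ⟨α * x ^ k, β, h1, h, by rwa [mul_assoc, ← pow_succ]⟩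
    · exact ih h

/-- The unit interval is the intersection of all affine preimages of `J` containing 0 and 1. Points
beyond 1 are excluded by `exists_affine_notMem`, negative ones after the reflection `x ↦ 1 - x`. -/
theorem yields_Icc {J : Set ℝ} (hJ : Convex ℝ J) {a b c : ℝ} (ha : a ∈ J) (hb : b ∈ J)
    (hab : a ≠ b) (hc : c ∉ J) : Yields J (Icc (0 : ℝ) 1) := by
  intro C hC
  have := Mem_iInter (C := C) (I := {p : ℝ × ℝ // p.2 ∈ J ∧ p.1 + p.2 ∈ J})
    (s := fun p => {s : ℝ | p.1.1 * s + p.1.2 ∈ J}) fun p => hC.rescale _ _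
  convert this using 1
  ext x
  simp only [Set.mem_iInter, mem_ofPred_eq]
  constructor
  · rintro ⟨h0, h1⟩ ⟨⟨α, β⟩, h2, h3⟩
    have := hJ h2 h3 (sub_nonneg.2 h1) h0 (by ring)
    simp only [smul_eq_mul] at this
    convert this using 1
    ring
  · intro h
    by_contra hx
    rw [mem_Icc, not_and_or, not_le, not_le] at hx
    rcases hx with hx | hx
    · obtain ⟨α, β, h1, h2, h3⟩ := exists_affine_notMem hJ ha hb hab hc (x := 1 - x) (by linarith)
      refine h3 ?_
      have := h ⟨(-α, α + β), h2, by simpa using h1⟩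
      simp only at this
      convert this using 1
      ring
    · obtain ⟨α, β, h1, h2, h3⟩ := exists_affine_notMem hJ ha hb hab hc hx
      exact h3 (h ⟨(α, β), h1, h2⟩)

/-- Intersect the preimages of `J` under `s ↦ α * s + a` over all `α > 0`: a negative `s` is sent to
`c` by a suitable `α`, and a nonnegative one stays in `J` because `J` is unbounded above. -/
theorem yields_Ici {J : Set ℝ} (hJ : Convex ℝ J) {a c : ℝ} (ha : a ∈ J) (hca : c < a) (hc : c ∉ J)
    (hu : ∀ M, ∃ x ∈ J, M ≤ x) : Yields J (Ici (0 : ℝ)) := by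
  intro C hC
  have := Mem_iInter (C := C) (I := {α : ℝ // 0 < α})
    (s := fun p => {s : ℝ | p.1 * s + a ∈ J}) fun p => hC.rescale _ _
  convert this using 1
  ext x
  simp only [Set.mem_iInter, mem_ofPred_eq, mem_Ici]
  constructor
  · rintro h0 ⟨α, hα⟩
    obtain ⟨y, hy, hy'⟩ := hu (α * x + a)
    exact mem_of_mem_of_le hJ ha hy (by nlinarith) hy'
  · intro h
    by_contra hx
    rw [not_le] at hx
    have := h ⟨(a - c) / (-x), div_pos (by linarith) (by linarith)⟩
    apply hc
    convert this using 1
    have hx0 := hx.ne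
    show c = (a - c) / (-x) * x + a
    field_simp
    ring

/-- Up to `b`, `J` is the half-open interval starting at its missing infimum `i`. Normalise it to
`(0, 1]` and intersect with the reflection at `1 / 2`. -/
theorem yields_Ioo {J : Set ℝ} (hJ : Convex ℝ J) (hne : J.Nonempty) {a : ℝ}
    (hb : ∀ x ∈ J, a ≤ x) (hmin : ∀ x ∈ J, ∃ y ∈ J, y < x) : Yields J (Ioo (0 : ℝ) 1) := by
  intro C hC
  have hbdd : BddBelow J := ⟨a, hb⟩
  obtain ⟨b, hbJ⟩ := hne
  set i := sInf J with hi
  have hlt : ∀ x ∈ J, i < x := fun x hx => by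
    obtain ⟨y, hy, hyx⟩ := hmin x hx
    exact (csInf_le hbdd hy).trans_lt hyx
  have hmem : ∀ x, i < x → x ≤ b → x ∈ J := fun x hx hxb => by
    obtain ⟨y, hy, hyx⟩ := exists_lt_of_csInf_lt ⟨b, hbJ⟩ hx
    exact mem_of_mem_of_le hJ hy hbJ hyx.le hxb
  have hd : 0 < b - i := sub_pos.2 (hlt b hbJ)
  have := (hC.rescale (b - i) i).and (hC.rescale (-(b - i)) b)
  convert this using 1
  ext x
  simp only [mem_Ioo, mem_ofPred_eq]
  constructor
  · rintro ⟨h0, h1⟩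
    constructor <;> apply hmem <;> nlinarith
  · rintro ⟨h0, h1⟩
    have h0' := hlt _ h0
    have h1' := hlt _ h1
    constructor <;> nlinarith

theorem Ioo_yields_Icc : Yields (Ioo (0 : ℝ) 1) (Icc (0 : ℝ) 1) :=
  yields_Icc (convex_Ioo 0 1) (a := 1 / 2) (b := 1 / 3) (c := 0) (by norm_num) (by norm_num)
    (by norm_num) (by simp)

theorem Ici_yields_Icc : Yields (Ici (0 : ℝ)) (Icc (0 : ℝ) 1) :=
  yields_Icc (convex_Ici 0) (a := 1) (b := 2) (c := -1) (by norm_num) (by norm_num)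
    (by norm_num) (by norm_num)

/-- The section at abscissa 1 is `(0, 1]`; intersect it with its reflection. -/
theorem pinchedSquare_yields_Ioo : Yields pinchedSquare (Ioo (0 : ℝ) 1) := by
  intro C hC
  have h1 : C.Mem {y : ℝ | ((1 : ℝ), y) ∈ pinchedSquare} :=
    hC.of_affine (LinearMap.inr ℝ ℝ ℝ) (1, 0) fun x => by simp
  have h2 := h1.and (h1.rescale (-1) 1)
  convert h2 using 1
  ext x
  simp only [mem_Ioo, pinchedSquare, mem_ofPred_eq]
  constructor
  · rintro ⟨h0, h1⟩
    exact ⟨⟨by linarith, by linarith, by norm_num, fun h => by linarith⟩, by linarith, by linarith,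
      by norm_num, fun h => by linarith⟩
  · rintro ⟨⟨h1, h2, -, h3⟩, h4, h5, -, h6⟩
    constructor
    · exact lt_of_le_of_ne h1 fun h => one_ne_zero (h3 h.symm)
    · exact lt_of_le_of_ne h2 fun h => one_ne_zero (h6 (by linarith))

theorem pinchedStrip_yields_pinchedSquare : Yields pinchedStrip pinchedSquare := by
  intro C hC
  have h1 : C.Mem {y : ℝ | ((1 : ℝ), y) ∈ pinchedStrip} :=
    hC.of_affine (LinearMap.inr ℝ ℝ ℝ) (1, 0) fun x => by simp
  have h2 : C.Mem (Icc (0 : ℝ) 1) := by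
    refine yields_Icc ?_ (a := 1) (b := 1 / 2) (c := 0) ?_ ?_ (by norm_num) ?_ C h1
    · have : {y : ℝ | ((1 : ℝ), y) ∈ pinchedStrip} = Ioc 0 1 := by
        ext y
        simp only [pinchedStrip, mem_ofPred_eq, mem_Ioc, one_ne_zero, imp_false]
        exact ⟨fun ⟨h1, h2, h3⟩ => ⟨lt_of_le_of_ne h1 (Ne.symm h3), h2⟩,
          fun ⟨h1, h2⟩ => ⟨h1.le, h2, h1.ne'⟩⟩
      rw [this]
      exact convex_Ioc 0 1
    all_goals norm_num [pinchedStrip]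
  have h3 := hC.and ((Mem_Icc h2 (c := -1) (d := 1) (by norm_num)).functional
    (LinearMap.fst ℝ ℝ ℝ) 0)
  convert h3 using 1
  ext ⟨x, y⟩
  simp [pinchedSquare, abs_le]
  tauto

/-- For `y, z ≥ 0` the half-space conditions `|x| ≤ ε * z + y / ε` for all `ε > 0` amount to `x ^ 2
≤ 4 * y * z`. Projecting this cone along `z` loses closedness: every `x` is reached when `y > 0`,
only `x = 0` when `y = 0`. -/
theorem Ici_yields_pinchedHalfPlane : Yields (Ici (0 : ℝ)) pinchedHalfPlane := by
  intro C hC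
  have h1 : C.Mem {q : (ℝ × ℝ) × ℝ | 0 ≤ q.2 ∧ ∀ p : {ε : ℝ // 0 < ε} × Bool,
      0 ≤ p.1.1 * q.2 + p.1.1⁻¹ * q.1.2 + bif p.2 then q.1.1 else -q.1.1} := by
    refine (hC.of_affine (LinearMap.snd ℝ (ℝ × ℝ) ℝ) 0 fun x => by simp).and
      (Mem_forall fun p => ?_)
    rcases p with ⟨ε, b | b⟩
    · refine hC.of_affine (ε.1 • LinearMap.snd ℝ (ℝ × ℝ) ℝ + ε.1⁻¹ • (LinearMap.snd ℝ ℝ ℝ ∘ₗ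
        LinearMap.fst ℝ (ℝ × ℝ) ℝ) - (LinearMap.fst ℝ ℝ ℝ ∘ₗ LinearMap.fst ℝ (ℝ × ℝ) ℝ)) 0
        fun x => ?_
      simp [sub_eq_add_neg]
    · refine hC.of_affine (ε.1 • LinearMap.snd ℝ (ℝ × ℝ) ℝ + ε.1⁻¹ • (LinearMap.snd ℝ ℝ ℝ ∘ₗ
        LinearMap.fst ℝ (ℝ × ℝ) ℝ) + (LinearMap.fst ℝ ℝ ℝ ∘ₗ LinearMap.fst ℝ (ℝ × ℝ) ℝ)) 0
        fun x => ?_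
      simp
  have h2 := (hC.functional (LinearMap.snd ℝ ℝ ℝ) 0).and h1.exists
  convert h2 using 1
  ext ⟨x, y⟩
  simp only [pinchedHalfPlane, mem_ofPred_eq, LinearMap.snd_apply, add_zero, mem_Ici]
  refine and_congr_right fun hy => ⟨fun h => ?_, ?_⟩
  · rcases hy.eq_or_lt with rfl | hy
    · refine ⟨0, le_rfl, fun p => ?_⟩
      simp [h rfl]
    · refine ⟨x ^ 2 / y, by positivity, fun ⟨⟨ε, hε⟩, b⟩ => ?_⟩
      have h0 : 2 * |x| ≤ ε * (x ^ 2 / y) + ε⁻¹ * y := by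
        have : ε * (x ^ 2 / y) + ε⁻¹ * y - 2 * |x| = (ε * |x| - y) ^ 2 / (ε * y) := by
          rw [← sq_abs x]
          field_simp
          ring
        have h' : 0 ≤ (ε * |x| - y) ^ 2 / (ε * y) := by positivity
        linarith
      have h1 := le_abs_self x
      have h2 := neg_abs_le x
      have h3 := abs_nonneg x
      cases b <;> simp only [cond_true, cond_false] <;> linarith
  · rintro ⟨z, hz, h⟩ rfl
    by_contra hx
    have hx' : 0 < |x| := abs_pos.2 hx
    -- At `y = 0` the condition reads `|x| ≤ ε * z`; this `ε` makes the right side smaller than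
    -- `|x|`.
    have hε : 0 < |x| / (2 * (z + 1)) := by positivity
    have h1 := h ⟨⟨_, hε⟩, true⟩
    have h2 := h ⟨⟨_, hε⟩, false⟩
    simp only [cond_true, cond_false, mul_zero, add_zero] at h1 h2
    have h3 : |x| / (2 * (z + 1)) * z < |x| := by
      rw [div_mul_eq_mul_div, div_lt_iff₀ (by positivity)]
      nlinarith
    have h4 : |x| ≤ |x| / (2 * (z + 1)) * z := abs_le.2 ⟨by linarith, by linarith⟩
    linarith

theorem Ici_yields_pinchedStrip : Yields (Ici (0 : ℝ)) pinchedStrip := by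
  intro C hC
  have h1 := (Ici_yields_pinchedHalfPlane C hC).and
    ((Ici_yields_Icc C hC).functional (LinearMap.snd ℝ ℝ ℝ) 0)
  convert h1 using 1
  ext ⟨x, y⟩
  simp [pinchedStrip]
  tauto

end InfPP

/-! ### Separation, gluing along faces, and the two ends of the chain. -/

namespace InfPP

open Set PPClass

/-- With nonempty interior this is Hahn–Banach. Otherwise some nonzero functional is constant on
`T`, and its sign can be chosen. -/
theorem exists_weak_separation {E : Type*} [NormedAddCommGroup E] [NormedSpace ℝ E]
    [FiniteDimensional ℝ E] {T : Set E} (hT : Convex ℝ T) (hne : T.Nonempty) {p : E} (hp : p ∉ T) :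
    ∃ l : E →ₗ[ℝ] ℝ, l ≠ 0 ∧ ∀ x ∈ T, l p ≤ l x := by
  by_cases hint : (interior T).Nonempty
  · obtain ⟨f, hf0, hf⟩ := geometric_hahn_banach_of_nonempty_interior_point hT
      (fun h => hp (interior_subset h)) hint
    refine ⟨-f.toLinearMap, fun h => hf0 ?_, fun x hx => by simpa using hf x hx⟩
    ext x
    have := LinearMap.congr_fun h x
    simpa using this
  · rw [hT.interior_nonempty_iff_affineSpan_eq_top] at hint
    obtain ⟨x₀, hx₀⟩ := hne
    have hdir : vectorSpan ℝ T < ⊤ := by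
      rw [lt_top_iff_ne_top]
      intro h
      exact hint ((AffineSubspace.affineSpan_eq_top_iff_vectorSpan_eq_top_of_nonempty ℝ E E
        ⟨x₀, hx₀⟩).2 h)
    obtain ⟨f, hf0, hf⟩ := Submodule.exists_le_ker_of_lt_top _ hdir
    have hconst : ∀ x ∈ T, f x = f x₀ := fun x hx => by
      have : f (x - x₀) = 0 := hf (vsub_mem_vectorSpan ℝ hx hx₀)
      rwa [map_sub, sub_eq_zero] at this
    rcases le_total (f p) (f x₀) with h | h
    · exact ⟨f, hf0, fun x hx => by rwa [hconst x hx]⟩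
    · exact ⟨-f, neg_ne_zero.2 hf0, fun x hx => by simpa [hconst x hx] using h⟩

theorem finrank_ker_lt {E : Type*} [AddCommGroup E] [Module ℝ E]
    [FiniteDimensional ℝ E] {l : E →ₗ[ℝ] ℝ} (hl : l ≠ 0) :
    Module.finrank ℝ (LinearMap.ker l) < Module.finrank ℝ E := by
  apply Submodule.finrank_lt
  exact fun h => hl (LinearMap.ker_eq_top.1 h)

theorem convex_section {E : Type*} [AddCommGroup E] [Module ℝ E] {T : Set E} (hT : Convex ℝ T)
    (V : Submodule ℝ E) (p : E) : Convex ℝ {v : V | p + v ∈ T} := by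
  intro u hu v hv a b ha hb hab
  have := hT hu hv ha hb hab
  simp only [mem_ofPred_eq] at this ⊢
  convert this using 1
  push_cast
  rw [smul_add, smul_add, add_add_add_comm, ← add_smul, hab, one_smul]

/-- A section is an affine preimage, so negative hypotheses survive the induction on dimension in
`PPClass.Mem_of_glue`. -/
theorem not_yields_section {E F : Type*} [AddCommGroup E] [Module ℝ E] [AddCommGroup F]
    [Module ℝ F] {R : Set F} {T : Set E} (hT : ¬ Yields T R) (V : Submodule ℝ E) (p : E) :
    ¬ Yields {v : V | p + v ∈ T} R := fun h =>
  hT (Yields.trans (fun _ hC => hC.of_affine V.subtype p fun v => by simp [add_comm]) h)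

/-- A point outside a nonempty convex set is properly separated from it. -/
theorem exists_proper_separation {E : Type*} [NormedAddCommGroup E] [NormedSpace ℝ E]
    [FiniteDimensional ℝ E] {T : Set E} (hT : Convex ℝ T) (hne : T.Nonempty) {p : E} (hp : p ∉ T) :
    ∃ l : E →ₗ[ℝ] ℝ, (∀ x ∈ T, l p ≤ l x) ∧ ∃ x ∈ T, l p < l x := by
  induction hd : Module.finrank ℝ E using Nat.strong_induction_on generalizing E with
  | _ d ih =>
  obtain ⟨l, hl0, hl⟩ := exists_weak_separation hT hne hp
  by_cases h : ∃ x ∈ T, l p < l x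
  · exact ⟨l, hl, h⟩
  push Not at h
  -- Otherwise `T` lies in the hyperplane through `p`; separate inside it, with `p` as origin, and
  -- extend the functional.
  have heq : ∀ x ∈ T, l x = l p := fun x hx => le_antisymm (h x hx) (hl x hx)
  let T' : Set (LinearMap.ker l) := {v | p + v ∈ T}
  have hT' : Convex ℝ T' := convex_section hT _ p
  have hlift : ∀ x ∈ T, ∃ v : LinearMap.ker l, v ∈ T' ∧ (v : E) = x - p := fun x hx =>
    ⟨⟨x - p, by simp [heq x hx]⟩, by simpa [T'] using hx, rfl⟩
  obtain ⟨x₀, hx₀⟩ := hne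
  obtain ⟨v₀, hv₀, -⟩ := hlift x₀ hx₀
  obtain ⟨l', h1, y, hy, h2⟩ := ih _ (hd ▸ finrank_ker_lt hl0) (p := (0 : LinearMap.ker l)) hT'
    ⟨v₀, hv₀⟩ (by simpa [T'] using hp) rfl
  obtain ⟨f, hf⟩ := LinearMap.exists_extend l'
  have hf' : ∀ v : LinearMap.ker l, f v = l' v := fun v => LinearMap.congr_fun hf v
  refine ⟨f, fun x hx => ?_, p + y, hy, ?_⟩
  · obtain ⟨v, hv, hvx⟩ := hlift x hx
    have := h1 v hv
    rw [← hf' v, hvx, map_sub, map_zero] at this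
    linarith
  · rw [map_add, hf']
    rw [map_zero] at h2
    linarith

/-- A property of convex sets that passes to hyperplane sections and provides suitable separating
sets and gluing relations inside the class implies membership in the class. -/
theorem PPClass.Mem_of_glue {C : PPClass}
    (P : ∀ (E : Type) [NormedAddCommGroup E] [NormedSpace ℝ E] [FiniteDimensional ℝ E],
      Set E → Prop)
    (hconv : ∀ (E : Type) [NormedAddCommGroup E] [NormedSpace ℝ E] [FiniteDimensional ℝ E]
      (T : Set E), P E T → Convex ℝ T)
    (hker : ∀ (E : Type) [NormedAddCommGroup E] [NormedSpace ℝ E] [FiniteDimensional ℝ E]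
      (T : Set E), P E T → ∀ (l : E →ₗ[ℝ] ℝ) (p : E), P (LinearMap.ker l) {v | p + v ∈ T})
    (hlt : ∀ (E : Type) [NormedAddCommGroup E] [NormedSpace ℝ E] [FiniteDimensional ℝ E]
      (T : Set E), P E T → ∀ (l : E →ₗ[ℝ] ℝ) (a : ℝ), (∀ x ∈ T, a < l x) →
        ∃ D : Set ℝ, C.Mem D ∧ a ∉ D ∧ ∀ x ∈ T, l x ∈ D)
    (hle : ∀ (E : Type) [NormedAddCommGroup E] [NormedSpace ℝ E] [FiniteDimensional ℝ E]
      (T : Set E), P E T → ∀ (l : E →ₗ[ℝ] ℝ) (a : ℝ), (∀ x ∈ T, a ≤ l x) → (∃ x ∈ T, l x = a) →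
        ∃ G : Set (E × ℝ), C.Mem G ∧ (∀ v, (v, (0 : ℝ)) ∈ G → v = 0) ∧
          ∀ x ∈ T, ∃ w ∈ T, l w = a ∧ (x - w, l x - a) ∈ G)
    {E : Type} [NormedAddCommGroup E] [NormedSpace ℝ E] [FiniteDimensional ℝ E] {T : Set E}
    (hT : P E T) : C.Mem T := by
  induction hd : Module.finrank ℝ E using Nat.strong_induction_on generalizing E with
  | _ d ih =>
  rcases T.eq_empty_or_nonempty with rfl | hne
  · exact Mem_empty
  -- `T` is the intersection of such `D` over all outside points, an intersection indexed by a type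
  -- in `Type`.
  suffices h : ∀ p : {p : E // p ∉ T}, ∃ D : Set E, C.Mem D ∧ p.1 ∉ D ∧ T ⊆ D by
    choose D hD hpD hTD using h
    convert Mem_iInter hD using 1
    ext x
    rw [Set.mem_iInter]
    refine ⟨fun hx p => hTD p hx, fun hx => ?_⟩
    by_contra hxT
    exact hpD ⟨x, hxT⟩ (hx _)
  rintro ⟨p, hp⟩
  obtain ⟨l, hl0, hl⟩ := exists_weak_separation (hconv E T hT) hne hp
  by_cases h : ∃ x ∈ T, l x = l p
  -- The hyperplane through `p` meets `T` in a section that lies in the class by induction. Take for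
  -- `D` the points related by `G` to a point of this section; at height 0 the relation is equality,
  -- so `p` is omitted.
  · obtain ⟨G, hG, hG0, hGT⟩ := hle E T hT l (l p) hl h
    have hT' := ih _ (hd ▸ finrank_ker_lt hl0) (hker E T hT l p) rfl
    have h1 : C.Mem {z : E × LinearMap.ker l | z.2 ∈ {v : LinearMap.ker l | p + v ∈ T}} :=
      hT'.of_affine (LinearMap.snd ℝ _ _) 0 fun z => by simp
    have h2 : C.Mem {z : E × LinearMap.ker l | (z.1 - p - z.2, l z.1 - l p) ∈ G} :=
      hG.of_affine ((LinearMap.fst ℝ _ _ - (LinearMap.ker l).subtype ∘ₗ LinearMap.snd ℝ _ _).prod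
        (l ∘ₗ LinearMap.fst ℝ _ _)) (-p, -l p) fun z => by
          simp only [mem_ofPred_eq]
          apply iff_of_eq
          congr 1
          ext <;> simp <;> abel
    refine ⟨_, (h1.and h2).exists, ?_, fun x hx => ?_⟩
    · rintro ⟨w, hw, hwG⟩
      simp only [sub_self, zero_sub] at hwG
      have := hG0 _ hwG
      rw [neg_eq_zero] at this
      simp only [mem_ofPred_eq, this, add_zero] at hw
      exact hp hw
    · obtain ⟨w, hw, hlw, hwG⟩ := hGT x hx
      refine ⟨⟨w - p, by simp [hlw]⟩, by simpa using hw, ?_⟩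
      simpa using hwG
  · obtain ⟨D, hD, haD, hTD⟩ := hlt E T hT l (l p) fun x hx =>
      lt_of_le_of_ne (hl x hx) fun h' => h ⟨x, hx, h'.symm⟩
    exact ⟨l ⁻¹' D, hD.of_affine l 0 fun x => by simp, haD, hTD⟩

section

variable {E : Type*} [AddCommGroup E] [Module ℝ E]

/-- Separation and gluing by means of a planar relation. -/
theorem exists_glue_of_planar [FiniteDimensional ℝ E] {C : PPClass} {T : Set E} {l : E →ₗ[ℝ] ℝ} {a : ℝ}
    {Q : Set (ℝ × ℝ)} (hQ : C.Mem Q) (hQ0 : ∀ s, (s, (0 : ℝ)) ∈ Q ↔ s = 0)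
    (hQT : ∀ x ∈ T, a < l x → ∀ w ∈ T, ∀ i,
      ((Module.finBasis ℝ E).coord i (x - w), l x - a) ∈ Q) (hle : ∀ x ∈ T, a ≤ l x)
    (hne : ∃ x ∈ T, l x = a) :
    ∃ G : Set (E × ℝ), C.Mem G ∧ (∀ v, (v, (0 : ℝ)) ∈ G → v = 0) ∧
          ∀ x ∈ T, ∃ w ∈ T, l w = a ∧ (x - w, l x - a) ∈ G := by
  refine ⟨{z | ∀ i, ((Module.finBasis ℝ E).coord i z.1, z.2) ∈ Q}, Mem_forall fun i => ?_, ?_, ?_⟩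
  · exact hQ.of_affine (((Module.finBasis ℝ E).coord i ∘ₗ LinearMap.fst ℝ _ _).prod
      (LinearMap.snd ℝ _ _)) 0 fun x => by simp
  · intro v hv
    rw [← (Module.finBasis ℝ E).forall_coord_eq_zero_iff]
    exact fun i => (hQ0 _).1 (hv i)
  · intro x hx
    rcases (hle x hx).eq_or_lt with h | h
    · refine ⟨x, hx, h.symm, fun i => ?_⟩
      simp [← h, hQ0]
    · obtain ⟨w, hw, hlw⟩ := hne
      exact ⟨w, hw, hlw, hQT x hx h w hw⟩

/-- The section of `Q` at abscissa 1 omits height 0; translate it by `a`. -/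
theorem exists_separating_of_planar {C : PPClass} {T : Set E} {l : E →ₗ[ℝ] ℝ} {a : ℝ}
    {Q : Set (ℝ × ℝ)} (hQ : C.Mem Q) (hQ0 : ∀ s, (s, (0 : ℝ)) ∈ Q ↔ s = 0)
    (hQT : ∀ x ∈ T, (1, l x - a) ∈ Q) :
    ∃ D : Set ℝ, C.Mem D ∧ a ∉ D ∧ ∀ x ∈ T, l x ∈ D := by
  refine ⟨{s | (1, s - a) ∈ Q}, hQ.of_affine (LinearMap.inr ℝ ℝ ℝ) (1, -a) fun x => ?_, ?_, hQT⟩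
  · simp [sub_eq_add_neg]
  · simp [hQ0]

end

/-- Every convex set is definable from a closed half line. -/
theorem Ici_yields_of_convex {E : Type} [NormedAddCommGroup E] [NormedSpace ℝ E]
    [FiniteDimensional ℝ E] {T : Set E} (hT : Convex ℝ T) :
    Yields (Ici (0 : ℝ)) T := by
  intro C hC
  have hQ := Ici_yields_pinchedHalfPlane C hC
  have hQ0 : ∀ s, (s, (0 : ℝ)) ∈ pinchedHalfPlane ↔ s = 0 := fun s => by simp [pinchedHalfPlane]
  refine Mem_of_glue (fun E _ _ _ T => Convex ℝ T) (fun E _ _ _ T h => h)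
    (fun E _ _ _ T h l p => convex_section h _ p) ?_ ?_ hT
  · intro E _ _ _ T _ l a hl
    refine exists_separating_of_planar hQ hQ0 fun x hx => ⟨(sub_pos.2 (hl x hx)).le, fun h => ?_⟩
    exact absurd h (sub_pos.2 (hl x hx)).ne'
  · intro E _ _ _ T _ l a hl hne
    refine exists_glue_of_planar hQ hQ0 (fun x hx h w hw i => ⟨(sub_pos.2 h).le, fun h' => ?_⟩)
      hl hne
    exact absurd h' (sub_pos.2 h).ne'

/-- Otherwise `l` maps `T` onto an interval bounded below and unbounded above, which yields `Ici 0`.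
-/
theorem bddAbove_of_not_yields_Ici {E : Type*} [AddCommGroup E] [Module ℝ E]
    [FiniteDimensional ℝ E] {T : Set E} (hT : Convex ℝ T)
    (h : ¬ Yields T (Ici (0 : ℝ))) {l : E →ₗ[ℝ] ℝ} {a : ℝ} (hl : ∀ x ∈ T, a ≤ l x) :
    ∃ M, 1 ≤ M ∧ ∀ x ∈ T, l x - a ≤ M := by
  by_contra hM
  push Not at hM
  obtain ⟨x₀, hx₀, -⟩ := hM 1 le_rfl
  refine h ((yields_image T l).trans (yields_Ici (hT.linear_image l) (mem_image_of_mem l hx₀)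
    (c := a - 1) (by linarith [hl x₀ hx₀]) ?_ fun M => ?_))
  · rintro ⟨x, hx, hxa⟩
    linarith [hl x hx]
  · obtain ⟨x, hx, h⟩ := hM (max 1 (M - a)) (le_max_left _ _)
    exact ⟨l x, mem_image_of_mem l hx, by linarith [le_max_right 1 (M - a)]⟩

/-- Heights `l x - a` over a supporting hyperplane are bounded, so a strip rescaled to height `M`
glues as well as the half plane does. -/
theorem pinchedStrip_yields_of_not_yields_Ici {E : Type} [NormedAddCommGroup E] [NormedSpace ℝ E]
    [FiniteDimensional ℝ E] {T : Set E} (hT : Convex ℝ T) (h : ¬ Yields T (Ici (0 : ℝ))) :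
    Yields pinchedStrip T := by
  intro C hC
  have hQ : ∀ M : ℝ, C.Mem {z : ℝ × ℝ | (z.1, M⁻¹ * z.2) ∈ pinchedStrip} := fun M =>
    hC.of_affine ((LinearMap.fst ℝ ℝ ℝ).prod (M⁻¹ • LinearMap.snd ℝ ℝ ℝ)) 0 fun x => by simp
  have hQ0 : ∀ M : ℝ, 1 ≤ M → ∀ s, (s, (0 : ℝ)) ∈ {z : ℝ × ℝ | (z.1, M⁻¹ * z.2) ∈ pinchedStrip}
    ↔ s = 0 := fun M hM s => by simp [pinchedStrip]
  have key : ∀ M : ℝ, 1 ≤ M → ∀ y, 0 < y → y ≤ M → ∀ s,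
      (s, y) ∈ {z : ℝ × ℝ | (z.1, M⁻¹ * z.2) ∈ pinchedStrip} := fun M hM y hy hyM s => by
    have hM0 : 0 < M := by linarith
    have : 0 < M⁻¹ * y := by positivity
    refine ⟨this.le, ?_, fun h => absurd h this.ne'⟩
    show M⁻¹ * y ≤ 1
    rwa [inv_mul_le_iff₀ hM0, mul_one]
  refine Mem_of_glue (fun E _ _ _ T => Convex ℝ T ∧ ¬ Yields T (Ici (0 : ℝ)))
    (fun E _ _ _ T h => h.1)
    (fun E _ _ _ T h l p => ⟨convex_section h.1 _ p, not_yields_section h.2 _ p⟩) ?_ ?_ ⟨hT, h⟩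
  · intro E _ _ _ T hT l a hl
    obtain ⟨M, hM, hTM⟩ := bddAbove_of_not_yields_Ici hT.1 hT.2 fun x hx => (hl x hx).le
    exact exists_separating_of_planar (hQ M) (hQ0 M hM) fun x hx =>
      key M hM _ (sub_pos.2 (hl x hx)) (hTM x hx) _
  · intro E _ _ _ T hT l a hl hne
    obtain ⟨M, hM, hTM⟩ := bddAbove_of_not_yields_Ici hT.1 hT.2 hl
    exact exists_glue_of_planar (hQ M) (hQ0 M hM) (fun x hx h w hw i =>
      key M hM _ (sub_pos.2 h) (hTM x hx) _) hl hne

/-- A functional bounded below on `T` must be constant there, since a nondegenerate proper interval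
yields `Icc 0 1`. Hence points and linear equations suffice for separation and gluing. -/
theorem yields_of_not_yields_Icc {E : Type} [NormedAddCommGroup E] [NormedSpace ℝ E]
    [FiniteDimensional ℝ E] {T : Set E} (hT : Convex ℝ T) (h : ¬ Yields T (Icc (0 : ℝ) 1)) :
    Yields (univ : Set ℝ) T := by
  intro C _
  have key : ∀ (E : Type) [NormedAddCommGroup E] [NormedSpace ℝ E] [FiniteDimensional ℝ E]
      (T : Set E), (Convex ℝ T ∧ ¬ Yields T (Icc (0 : ℝ) 1)) → ∀ (l : E →ₗ[ℝ] ℝ) (a : ℝ),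
      (∀ x ∈ T, a ≤ l x) → ∀ x ∈ T, ∀ y ∈ T, l x = l y := by
    intro E _ _ _ T hT l a hl x hx y hy
    by_contra hne
    refine hT.2 ((yields_image T l).trans (yields_Icc (hT.1.linear_image l)
      (mem_image_of_mem l hx) (mem_image_of_mem l hy) hne (c := a - 1) ?_))
    rintro ⟨z, hz, hza⟩
    linarith [hl z hz]
  refine Mem_of_glue (fun E _ _ _ T => Convex ℝ T ∧ ¬ Yields T (Icc (0 : ℝ) 1))
    (fun E _ _ _ T h => h.1)
    (fun E _ _ _ T h l p => ⟨convex_section h.1 _ p, not_yields_section h.2 _ p⟩) ?_ ?_ ⟨hT, h⟩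
  · intro E _ _ _ T hT l a hl
    rcases T.eq_empty_or_nonempty with rfl | ⟨x₀, hx₀⟩
    · exact ⟨∅, Mem_empty, by simp, by simp⟩
    · refine ⟨{l x₀}, ?_, (hl x₀ hx₀).ne, fun x hx => key E T hT l a (fun x hx => (hl x hx).le)
        x hx x₀ hx₀⟩
      exact Mem_zero_real.of_affine LinearMap.id (-l x₀) fun x => by
        simp [← sub_eq_add_neg, sub_eq_zero]
  · rintro E _ _ _ T hT l a hl ⟨x₀, hx₀, rfl⟩
    refine ⟨{z | z.1 = 0}, Mem_zero.of_affine (LinearMap.fst ℝ _ _) 0 fun x => by simp,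
      fun v hv => hv, fun x hx => ⟨x, hx, key E T hT l _ hl x hx x₀ hx₀, by simp⟩⟩

end InfPP

/-! ### Reduction of unbounded convex sets to bounded ones. -/

namespace InfPP

open Set PPClass Filter Topology

/-- From a relative interior point one can move slightly away from any `x` inside `T`; if `l x`
exceeded the minimum `l c`, this would go below it. -/
theorem exists_relInterior_point {E : Type*} [NormedAddCommGroup E] [NormedSpace ℝ E]
    [FiniteDimensional ℝ E] {T : Set E} (hT : Convex ℝ T) (hne : T.Nonempty) :
    ∃ c ∈ T, ∀ l : E →ₗ[ℝ] ℝ, (∀ x ∈ T, l c ≤ l x) → ∀ x ∈ T, l x = l c := by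
  obtain ⟨c, hc⟩ := hne.intrinsicInterior hT
  have hcT := intrinsicInterior_subset hc
  refine ⟨c, hcT, fun l hl x hx => le_antisymm ?_ (hl x hx)⟩
  obtain ⟨y, hy, rfl⟩ := mem_intrinsicInterior.1 hc
  let γ : ℝ → affineSpan ℝ T := fun t =>
    ⟨AffineMap.lineMap (y : E) x t, AffineMap.lineMap_mem t y.2 (mem_affineSpan ℝ hx)⟩
  have hγ : Continuous γ := Continuous.subtype_mk AffineMap.lineMap_continuous _
  have hγ0 : γ 0 = y := Subtype.ext (by simp [γ])
  have h1 : ∀ᶠ t in 𝓝 (0 : ℝ), γ t ∈ interior ((↑) ⁻¹' T : Set (affineSpan ℝ T)) :=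
    hγ.continuousAt.eventually_mem (isOpen_interior.mem_nhds (by rwa [hγ0]))
  have h2 : ∀ᶠ t in 𝓝[<] (0 : ℝ), γ t ∈ interior ((↑) ⁻¹' T : Set (affineSpan ℝ T)) :=
    h1.filter_mono nhdsWithin_le_nhds
  obtain ⟨t, ht, ht0⟩ := (h2.and self_mem_nhdsWithin).exists
  have htT : γ t ∈ ((↑) ⁻¹' T : Set (affineSpan ℝ T)) := interior_subset ht
  have h3 := hl _ htT
  have h4 : l (γ t : E) = l y + t * (l x - l y) := by
    simp [γ, AffineMap.lineMap_apply]
    ring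
  rw [h4] at h3
  have ht0' : t < 0 := ht0
  nlinarith

/-- The functionals that are bounded on `T`. -/
def boundedDual {E : Type*} [AddCommGroup E] [Module ℝ E] (T : Set E) :
    Submodule ℝ (E →ₗ[ℝ] ℝ) where
  carrier := {l | ∃ M, ∀ x ∈ T, |l x| ≤ M}
  zero_mem' := ⟨0, by simp⟩
  add_mem' := by
    rintro l l' ⟨M, h⟩ ⟨M', h'⟩
    exact ⟨M + M', fun x hx => (abs_add_le _ _).trans (add_le_add (h x hx) (h' x hx))⟩
  smul_mem' := by
    rintro r l ⟨M, h⟩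
    refine ⟨|r| * M, fun x hx => ?_⟩
    rw [LinearMap.smul_apply, smul_eq_mul, abs_mul]
    exact mul_le_mul_of_nonneg_left (h x hx) (abs_nonneg r)

theorem mem_boundedDual_of_le {E : Type} [NormedAddCommGroup E] [NormedSpace ℝ E]
    [FiniteDimensional ℝ E] {T : Set E} (hT : Convex ℝ T) (h : ¬ Yields T (Ici (0 : ℝ)))
    {l : E →ₗ[ℝ] ℝ} {a : ℝ} (hl : ∀ x ∈ T, a ≤ l x) : l ∈ boundedDual T := by
  obtain ⟨M, -, hM⟩ := bddAbove_of_not_yields_Ici hT h hl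
  refine ⟨M + |a|, fun x hx => abs_le.2 ⟨?_, ?_⟩⟩
  · have h1 := hl x hx
    have h2 := hM x hx
    linarith [neg_abs_le a]
  · linarith [hM x hx, le_abs_self a]

/-- If a convex set is invariant in the relative interior, but not everywhere, under a direction,
then it yields the pinched strip. -/
theorem yields_pinchedStrip {E : Type*} [AddCommGroup E] [Module ℝ E]
    {T : Set E} (hT : Convex ℝ T) {x v c : E} (hx : x ∈ T) (hxv : x + v ∉ T)
    (hc : ∀ s : ℝ, c + s • v ∈ T) : Yields T pinchedStrip := by
  intro C hC
  -- The segment from `x` to `c + (s / r) • v` passes through this point at parameter `r`.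
  have hmem : ∀ s r : ℝ, 0 < r → r ≤ 1 → x + s • v + r • (c - x) ∈ T := fun s r hr hr1 => by
    have := hT hx (hc (s / r)) (sub_nonneg.2 hr1) hr.le (by ring)
    convert this using 1
    rw [smul_add, smul_smul, mul_div_cancel₀ _ hr.ne', smul_sub, sub_smul, one_smul]
    abel
  have hIcc : C.Mem (Icc (0 : ℝ) 1) := by
    have hline := hC.line (x + v) (c - x)
    refine yields_Icc ?_ (a := 1) (b := 1 / 2) (c := 0) ?_ ?_ (by norm_num) ?_ C hline
    · intro s hs t ht p q hp hq hpq
      have := hT hs ht hp hq hpq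
      simp only [mem_ofPred_eq] at this ⊢
      convert this using 1
      rw [smul_add p, smul_add q, add_add_add_comm, ← add_smul, hpq, one_smul, smul_smul, smul_smul,
        ← add_smul]
      rfl
    · simpa using hmem 1 1 one_pos le_rfl
    · simpa using hmem 1 (1 / 2) (by norm_num) (by norm_num)
    · simpa using hxv
  have hK : ∀ n : ℝ, C.Mem {z : ℝ × ℝ | x + (n * z.1) • v + z.2 • (c - x) ∈ T} := fun n => by
    refine hC.of_affine (LinearMap.toSpanSingleton ℝ E v ∘ₗ (n • LinearMap.fst ℝ ℝ ℝ) +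
      LinearMap.toSpanSingleton ℝ E (c - x) ∘ₗ LinearMap.snd ℝ ℝ ℝ) x fun z => ?_
    simp only [mem_ofPred_eq]
    apply iff_of_eq
    congr 1
    simp
    abel
  -- At positive height nothing is lost by scaling the direction `v`. At height 0 a multiple `±n *
  -- s` exceeds 1 unless `s = 0`, and convexity would then put `x + v` into `T`.
  have hall : C.Mem {z : ℝ × ℝ | ∀ n : ℕ, x + ((n : ℝ) * z.1) • v + z.2 • (c - x) ∈ T ∧
      x + ((-n : ℝ) * z.1) • v + z.2 • (c - x) ∈ T} := Mem_forall fun n => (hK n).and (hK (-n))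
  have := (hIcc.functional (LinearMap.snd ℝ ℝ ℝ) 0).and hall
  convert this using 1
  ext ⟨s, r⟩
  simp only [pinchedStrip, mem_ofPred_eq, LinearMap.snd_apply, add_zero, mem_Icc, and_assoc]
  refine and_congr_right fun h0 => and_congr_right fun h1 => ⟨fun h n => ?_, ?_⟩
  · rcases h0.eq_or_lt with h' | h'
    · simp [h h'.symm, ← h', hx]
    · exact ⟨hmem _ _ h' h1, hmem _ _ h' h1⟩
  · rintro h rfl
    by_contra hs
    have hs' : 0 < |s| := abs_pos.2 hs
    obtain ⟨n, hn⟩ := exists_nat_gt (1 / |s|)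
    rw [div_lt_iff₀ hs'] at hn
    have key : ∃ t : ℝ, 1 ≤ t ∧ x + t • v ∈ T := by
      obtain ⟨ha, hb⟩ := h n
      simp only [zero_smul, add_zero] at ha hb
      rcases abs_cases s with ⟨h', -⟩ | ⟨h', -⟩
      · exact ⟨n * s, by rw [h'] at hn; exact hn.le, ha⟩
      · exact ⟨-n * s, by rw [h'] at hn; linarith, hb⟩
    obtain ⟨t, ht, htT⟩ := key
    have ht0 : 0 < t := by linarith
    apply hxv
    have := hT hx htT (a := 1 - 1 / t) (b := 1 / t)
      (sub_nonneg.2 ((div_le_one ht0).2 ht)) (by positivity) (by ring)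
    convert this using 1
    rw [smul_add, smul_smul, one_div_mul_cancel ht0.ne', sub_smul, one_smul, one_smul]
    abel

/-- A convex set that does not yield the pinched strip is a product of a bounded set and a
linear subspace. -/
theorem exists_bounded_projection {E : Type} [NormedAddCommGroup E] [NormedSpace ℝ E]
    [FiniteDimensional ℝ E] {T : Set E} (hT : Convex ℝ T) (h : ¬ Yields T pinchedStrip) :
    ∃ (k : ℕ) (π : E →ₗ[ℝ] (Fin k → ℝ)), (∃ M, ∀ x ∈ T, ‖π x‖ ≤ M) ∧
      ∀ x, x ∈ T ↔ π x ∈ π '' T := by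
  rcases T.eq_empty_or_nonempty with rfl | hne
  · exact ⟨0, 0, ⟨0, by simp⟩, by simp⟩
  have hIci : ¬ Yields T (Ici (0 : ℝ)) := fun h' => h (h'.trans Ici_yields_pinchedStrip)
  -- Finitely many generators of the bounded functionals are the coordinates of the projection.
  obtain ⟨k, b, hb⟩ := Submodule.fg_iff_exists_fin_generating_family.1
    (IsNoetherian.noetherian (boundedDual T))
  have hbmem : ∀ i, b i ∈ boundedDual T := fun i => hb ▸ Submodule.subset_span (mem_range_self i)
  refine ⟨_, LinearMap.pi b, ?_, fun x => ⟨mem_image_of_mem _, ?_⟩⟩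
  · choose M hM using hbmem
    refine ⟨∑ i, |M i|, fun x hx => (pi_norm_le_iff_of_nonneg (by positivity)).2 fun i => ?_⟩
    exact (hM i x hx).trans ((le_abs_self _).trans
      (Finset.single_le_sum (f := fun i => |M i|) (fun i _ => abs_nonneg _) (Finset.mem_univ i)))
  · rintro ⟨y, hy, hyx⟩
    have hker : ∀ l ∈ boundedDual T, l (x - y) = 0 := by
      have : boundedDual T ≤ LinearMap.ker (LinearMap.applyₗ (x - y) : (E →ₗ[ℝ] ℝ) →ₗ[ℝ] ℝ) := by
        rw [← hb, Submodule.span_le]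
        rintro _ ⟨i, rfl⟩
        have := congrFun hyx i
        simp only [LinearMap.pi_apply] at this
        simp [this]
      exact fun l hl => this hl
    by_contra hxT
    obtain ⟨c, hc, hcl⟩ := exists_relInterior_point hT hne
    -- The line through `c` in direction `x - y` stays in `T`: a functional properly separating one
    -- of its points is bounded on `T`, hence vanishes on `x - y`, hence is minimal at `c` without
    -- being constant on `T`.
    refine h (yields_pinchedStrip hT hy (v := x - y) (c := c) (by simpa using hxT) fun s => ?_)
    by_contra hs
    obtain ⟨l, hl, z, hz, hlz⟩ := exists_proper_separation hT hne hs
    have hl0 := hker l (mem_boundedDual_of_le hT hIci hl)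
    simp only [map_add, map_smul, hl0, smul_zero, add_zero] at hl hlz
    exact hlz.ne' (hcl l hl z hz)

end InfPP

/-! ### Bounded convex sets. -/

namespace InfPP

open Set PPClass Filter Topology

/-- A planar convex set lying above the axis, touching it only to the left of the origin, and
having `(1, 0)` in its closure yields the pinched square. -/
theorem yields_pinchedSquare_of_planar {K : Set (ℝ × ℝ)} (hK : Convex ℝ K)
    (h0 : ∀ z ∈ K, 0 ≤ z.2) {j₀ : ℝ} (hj₀ : (j₀, (0 : ℝ)) ∈ K)
    (hJ : ∀ x, (x, (0 : ℝ)) ∈ K → x ≤ 0)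
    (hlim : ∀ η : ℝ, 0 < η → ∃ z ∈ K, |z.1 - 1| < η ∧ |z.2| < η) : Yields K pinchedSquare := by
  intro C hC
  have hpos : ∀ z ∈ K, 0 < z.1 → 0 < z.2 := by
    rintro ⟨x, y⟩ hz hx
    refine lt_of_le_of_ne (h0 _ hz) ?_
    rintro rfl
    exact absurd (hJ x hz) (not_le.2 hx)
  have hseg : ∀ z ∈ K, ∀ w ∈ K, ∀ y, w.2 ≤ y → y ≤ z.2 → w.2 < z.2 → ∃ θ, 0 ≤ θ ∧ θ ≤ 1 ∧
      θ * (z.2 - w.2) = y - w.2 ∧ ((1 - θ) * w.1 + θ * z.1, y) ∈ K := by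
    rintro ⟨x₁, y₁⟩ hz ⟨x₂, y₂⟩ hw y h1 h2 h3
    simp only at h1 h2 h3 ⊢
    have hd : 0 < y₁ - y₂ := sub_pos.2 h3
    have hθ0 : 0 ≤ (y - y₂) / (y₁ - y₂) := div_nonneg (by linarith) hd.le
    have hθ1 : (y - y₂) / (y₁ - y₂) ≤ 1 := (div_le_one hd).2 (by linarith)
    have hθ : (y - y₂) / (y₁ - y₂) * (y₁ - y₂) = y - y₂ := div_mul_cancel₀ _ hd.ne'
    refine ⟨_, hθ0, hθ1, hθ, ?_⟩
    convert hK hw hz (sub_nonneg.2 hθ1) hθ0 (by ring) using 1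
    ext
    · simp
    · simp only [Prod.smul_mk, smul_eq_mul, Prod.mk_add_mk]
      linarith
  obtain ⟨⟨x₀, y₀⟩, hz₀, hx₀, -⟩ := hlim (1 / 4) (by norm_num)
  rw [abs_lt] at hx₀
  have hy₀ : 0 < y₀ := hpos _ hz₀ (by simp only at hx₀ ⊢; linarith)
  simp only at hx₀
  have hjle : j₀ ≤ 0 := hJ _ hj₀
  -- the sections at small positive height contain `[1/4, 3/4]`
  have hmid : ∀ y, 0 < y → y ≤ y₀ / 5 → ∀ x, 1 / 4 ≤ x → x ≤ 3 / 4 → (x, y) ∈ K := by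
    intro y hy hy5 x hx1 hx2
    -- On the segment from `(j₀, 0)` to `(x₀, y₀)` height at most `y₀ / 5` means `θ ≤ 1 / 5`; with
    -- `j₀ ≤ 0` and `x₀ < 5 / 4` the abscissa is at most `1 / 4`. Starting near `(1, 0)` instead
    -- keeps it above `3 / 4`.
    obtain ⟨θ, hθ0, hθ1, hθ, hl⟩ := hseg _ hz₀ _ hj₀ y hy.le (by simp only; linarith) hy₀
    simp only [sub_zero] at hθ hl
    have hθ5 : θ ≤ 1 / 5 := by
      by_contra h
      nlinarith
    obtain ⟨⟨x₁, y₁⟩, hz₁, hx₁, hy₁⟩ := hlim (min (1 / 4) y) (by positivity)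
    have hx₁' := (abs_lt.1 (hx₁.trans_le (min_le_left _ _))).1
    have hy₁' := (abs_lt.1 (hy₁.trans_le (min_le_right _ _))).2
    simp only at hx₁' hy₁'
    obtain ⟨τ, hτ0, hτ1, -, hr⟩ := hseg _ hz₀ _ hz₁ y hy₁'.le (by simp only; linarith)
      (by simp only; linarith)
    simp only at hr
    have hl' : (1 - θ) * j₀ + θ * x₀ ≤ 1 / 4 := by nlinarith
    have hr' : 3 / 4 ≤ (1 - τ) * x₁ + τ * x₀ := by nlinarith
    have hsec : Convex ℝ {s : ℝ | (s, y) ∈ K} := by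
      intro s hs t ht a b ha hb hab
      have := hK hs ht ha hb hab
      simp only [mem_ofPred_eq] at this ⊢
      convert this using 1
      ext
      · simp
      · simp [← add_mul, hab]
    exact mem_of_mem_of_le hsec hl hr (hl'.trans hx1) (hx2.trans hr')
  set J : Set ℝ := {x | (x, (0 : ℝ)) ∈ K} with hJdef
  have hJbdd : BddAbove J := ⟨0, fun x hx => hJ x hx⟩
  have hex : ∀ n : ℕ, ∃ j ∈ J, sSup J - 1 / (n + 1 : ℝ) < j := fun n =>
    exists_lt_of_lt_csSup ⟨j₀, hj₀⟩ (sub_lt_self _ (by positivity))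
  choose j hjJ hj using hex
  have hIcc : C.Mem (Icc (0 : ℝ) 1) := by
    refine Yields.trans (yields_image K (LinearMap.snd ℝ ℝ ℝ)) (yields_Icc (hK.linear_image _)
      (a := 0) (b := y₀) (c := -1) ⟨_, hj₀, rfl⟩ ⟨_, hz₀, rfl⟩ hy₀.ne ?_) C hC
    rintro ⟨z, hz, hz'⟩
    have := h0 z hz
    simp only [LinearMap.snd_apply] at hz'
    linarith
  -- Take differences of two points of a section, both at least `j n`. At height 0 both lie within
  -- `1 / (n + 1)` of `sSup J`, so only difference 0 survives all `n`; at positive height `[1/4,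
  -- 3/4]` provides every difference up to `1 / 2`.
  have hdiff : ∀ n, C.Mem {z : ℝ × ℝ | ∃ x : ℝ, ((x, y₀ / 5 * z.2) ∈ K ∧ x ∈ Icc (j n) 1) ∧
      (2⁻¹ * z.1 + x, y₀ / 5 * z.2) ∈ K ∧ 2⁻¹ * z.1 + x ∈ Icc (j n) 1} := fun n => by
    have hjn : j n < 1 := lt_of_le_of_lt (hJ _ (hjJ n)) one_pos
    have hI := Mem_Icc hIcc hjn
    let p : (ℝ × ℝ) × ℝ →ₗ[ℝ] ℝ := LinearMap.snd ℝ _ _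
    let q : (ℝ × ℝ) × ℝ →ₗ[ℝ] ℝ := (y₀ / 5) • (LinearMap.snd ℝ ℝ ℝ ∘ₗ LinearMap.fst ℝ _ _)
    let r : (ℝ × ℝ) × ℝ →ₗ[ℝ] ℝ := (2⁻¹ : ℝ) • (LinearMap.fst ℝ ℝ ℝ ∘ₗ LinearMap.fst ℝ _ _) + p
    have h1 : C.Mem {z : (ℝ × ℝ) × ℝ | (z.2, y₀ / 5 * z.1.2) ∈ K} :=
      hC.of_affine (p.prod q) 0 fun z => by simp [p, q]
    have h2 : C.Mem {z : (ℝ × ℝ) × ℝ | z.2 ∈ Icc (j n) 1} :=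
      hI.of_affine p 0 fun z => by simp [p]
    have h3 : C.Mem {z : (ℝ × ℝ) × ℝ | (2⁻¹ * z.1.1 + z.2, y₀ / 5 * z.1.2) ∈ K} :=
      hC.of_affine (r.prod q) 0 fun z => by simp [p, q, r]
    have h4 : C.Mem {z : (ℝ × ℝ) × ℝ | 2⁻¹ * z.1.1 + z.2 ∈ Icc (j n) 1} :=
      hI.of_affine r 0 fun z => by simp [p, r]
    exact ((h1.and h2).and (h3.and h4)).exists
  have hall := ((hIcc.functional (LinearMap.snd ℝ ℝ ℝ) 0).and ((Mem_Icc hIcc (c := -1) (d := 1)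
    (by norm_num)).functional (LinearMap.fst ℝ ℝ ℝ) 0)).and (Mem_forall hdiff)
  convert hall using 1
  ext ⟨x, y⟩
  simp only [pinchedSquare, mem_ofPred_eq, LinearMap.snd_apply, LinearMap.fst_apply, add_zero,
    mem_Icc, abs_le]
  constructor
  · rintro ⟨hy0, hy1, ⟨hx1, hx2⟩, hxy⟩
    refine ⟨⟨⟨hy0, hy1⟩, hx1, hx2⟩, fun n => ?_⟩
    have hjn : j n ≤ 0 := hJ _ (hjJ n)
    rcases hy0.eq_or_lt with rfl | hy
    · have := hjJ n
      refine ⟨j n, ⟨by rwa [mul_zero], le_rfl, by linarith⟩, ?_⟩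
      rw [hxy rfl]
      rw [mul_zero, mul_zero, zero_add]
      exact ⟨this, le_rfl, by linarith⟩
    · have hy' : 0 < y₀ / 5 * y := by positivity
      have hy'' : y₀ / 5 * y ≤ y₀ / 5 := by nlinarith
      refine ⟨1 / 2 - x / 4, ⟨hmid _ hy' hy'' _ (by linarith) (by linarith), by linarith,
        by linarith⟩, hmid _ hy' hy'' _ (by linarith) (by linarith), by linarith, by linarith⟩
  · rintro ⟨⟨⟨hy0, hy1⟩, hx1, hx2⟩, h⟩
    refine ⟨hy0, hy1, ⟨hx1, hx2⟩, ?_⟩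
    rintro rfl
    have hsmall : ∀ n : ℕ, |x| ≤ 2 * (1 / (n + 1 : ℝ)) := fun n => by
      obtain ⟨w, ⟨hw, hw1, -⟩, hw', hw1', -⟩ := h n
      simp only [mul_zero] at hw hw'
      have h1 : w ≤ sSup J := le_csSup hJbdd hw
      have h2 : 2⁻¹ * x + w ≤ sSup J := le_csSup hJbdd hw'
      have h3 := hj n
      rw [abs_le]
      constructor <;> linarith
    have hlim0 : Tendsto (fun n : ℕ => 2 * (1 / (n + 1 : ℝ))) atTop (𝓝 0) := by
      simpa using (tendsto_one_div_add_atTop_nhds_zero_nat (𝕜 := ℝ)).const_mul 2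
    exact abs_nonpos_iff.1 (ge_of_tendsto' hlim0 hsmall)

theorem bounded_section {E : Type*} [NormedAddCommGroup E] [NormedSpace ℝ E] {T : Set E} (hb : ∃ M, ∀ x ∈ T, ‖x‖ ≤ M) (V : Submodule ℝ E) (p : E) :
    ∃ M, ∀ v ∈ {v : V | p + v ∈ T}, ‖v‖ ≤ M := by
  obtain ⟨M, hM⟩ := hb
  refine ⟨M + ‖p‖, fun v hv => ?_⟩
  have h1 := hM _ hv
  have h2 := norm_sub_le (p + v) p
  rw [add_sub_cancel_left] at h2
  calc ‖v‖ = ‖(v : E)‖ := rfl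
    _ ≤ M + ‖p‖ := by linarith

section

variable {E : Type*} [NormedAddCommGroup E] [NormedSpace ℝ E] [FiniteDimensional ℝ E]

/-- If not, Hahn–Banach separates `q` from the closed face by some `f`. Under normalised `f` and `l
- a`, the face goes to the left half of the axis and `q` to `(1, 0)`, so
`yields_pinchedSquare_of_planar` applies. -/
theorem mem_closure_face {T : Set E} (hT : Convex ℝ T) (h : ¬ Yields T pinchedSquare)
    {l : E →ₗ[ℝ] ℝ} {a : ℝ} (hl : ∀ x ∈ T, a ≤ l x) (hne : ∃ x ∈ T, l x = a) {q : E}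
    (hq : q ∈ closure T) (hqa : l q = a) : q ∈ closure {x ∈ T | l x = a} := by
  by_contra hq'
  have hconv : Convex ℝ {x ∈ T | l x = a} :=
    hT.inter (convex_hyperplane l.isLinear a)
  obtain ⟨f, u, hfu, hfq⟩ := geometric_hahn_banach_closed_point hconv.closure isClosed_closure hq'
  have hd : 0 < f q - u := sub_pos.2 hfq
  let g : E →ₗ[ℝ] ℝ × ℝ := ((f q - u)⁻¹ • f.toLinearMap).prod l
  have hlc : Continuous l := l.continuous_of_finiteDimensional
  let c : ℝ × ℝ := (-(f q - u)⁻¹ * u, -a)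
  have hg : ∀ x, g x + c = ((f x - u) / (f q - u), l x - a) := fun x => by
    ext
    · simp [g, c]
      ring
    · simp [g, c, sub_eq_add_neg]
  refine h (Yields.trans (t := {y | ∃ x ∈ T, g x + c = y}) (fun C hC => hC.image g c) ?_)
  obtain ⟨x₀, hx₀, hx₀a⟩ := hne
  refine yields_pinchedSquare_of_planar ?_ ?_ (j₀ := (f x₀ - u) / (f q - u)) ?_ ?_ ?_
  · rintro _ ⟨x, hx, rfl⟩ _ ⟨y, hy, rfl⟩ s t hs ht hst
    refine ⟨s • x + t • y, hT hx hy hs ht hst, ?_⟩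
    rw [map_add, map_smul, map_smul, smul_add, smul_add, add_add_add_comm, ← add_smul, hst,
      one_smul]
  · rintro _ ⟨x, hx, rfl⟩
    rw [hg]
    exact sub_nonneg.2 (hl x hx)
  · exact ⟨x₀, hx₀, by rw [hg, hx₀a, sub_self]⟩
  · rintro s ⟨x, hx, hxs⟩
    rw [hg, Prod.mk.injEq] at hxs
    rw [← hxs.1]
    refine div_nonpos_of_nonpos_of_nonneg ?_ hd.le
    have := hfu x (subset_closure ⟨hx, sub_eq_zero.1 hxs.2⟩)
    linarith
  · intro η hη
    have hcont : Continuous fun x => ((f x - u) / (f q - u), l x - a) := by fun_prop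
    have hq1 : ((f q - u) / (f q - u), l q - a) = ((1 : ℝ), (0 : ℝ)) := by
      rw [div_self hd.ne', hqa, sub_self]
    have hnhds : ∀ᶠ z : ℝ × ℝ in 𝓝 ((1 : ℝ), (0 : ℝ)), dist z (1, 0) < η :=
      Metric.ball_mem_nhds _ hη
    have hev : ∀ᶠ x in 𝓝 q, dist ((f x - u) / (f q - u), l x - a) ((1 : ℝ), (0 : ℝ)) < η := by
      rw [← hq1] at hnhds ⊢
      exact hcont.continuousAt.eventually hnhds
    obtain ⟨x, hx, hxT⟩ := mem_closure_iff_nhds.1 hq _ hev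
    refine ⟨_, ⟨x, hxT, rfl⟩, ?_⟩
    rw [hg]
    rw [mem_ofPred_eq, Prod.dist_eq, max_lt_iff, Real.dist_eq, Real.dist_eq] at hx
    simpa using hx

theorem exists_abs_le {T : Set E} (hb : ∃ M, ∀ x ∈ T, ‖x‖ ≤ M) (l : E →ₗ[ℝ] ℝ) (a : ℝ) :
    ∃ M, 1 ≤ M ∧ ∀ x ∈ T, l x - a < M := by
  obtain ⟨M, hM⟩ := hb
  refine ⟨‖LinearMap.toContinuousLinearMap l‖ * |M| + |a| + 1, ?_, fun x hx => ?_⟩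
  · have : 0 ≤ ‖LinearMap.toContinuousLinearMap l‖ * |M| := by positivity
    linarith [abs_nonneg a]
  · have h1 := (LinearMap.toContinuousLinearMap l).le_opNorm x
    have h2 : ‖LinearMap.toContinuousLinearMap l‖ * ‖x‖ ≤
        ‖LinearMap.toContinuousLinearMap l‖ * |M| :=
      mul_le_mul_of_nonneg_left ((hM x hx).trans (le_abs_self M)) (norm_nonneg _)
    have h3 : l x ≤ ‖LinearMap.toContinuousLinearMap l x‖ := le_abs_self (l x)
    linarith [neg_abs_le a]

/-- Points of a bounded convex set with small value of a functional are close to the face where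
the functional is minimal. -/
theorem exists_modulus {T : Set E} (hb : ∃ M, ∀ x ∈ T, ‖x‖ ≤ M) {l : E →ₗ[ℝ] ℝ} {a : ℝ}
    (hl : ∀ x ∈ T, a ≤ l x) (hne : ∃ x ∈ T, l x = a)
    (hcl : ∀ q ∈ closure T, l q = a → q ∈ closure {x ∈ T | l x = a}) {ε : ℝ} (hε : 0 < ε) :
    ∃ D, 0 ≤ D ∧ ∀ x ∈ T, Metric.infDist x {x ∈ T | l x = a} ≤ ε + D * (l x - a) := by
  set F := {x ∈ T | l x = a} with hF
  have hFne : F.Nonempty := hne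
  obtain ⟨M, hM⟩ := hb
  have hlc : Continuous l := l.continuous_of_finiteDimensional
  have hcompact : IsCompact (closure T) :=
    Metric.isCompact_of_isClosed_isBounded isClosed_closure
      ((isBounded_iff_forall_norm_le.2 ⟨M, hM⟩).closure)
  have hclosed : IsClosed {x | ε ≤ Metric.infDist x F} :=
    isClosed_le continuous_const (Metric.continuous_infDist_pt F)
  have hK := hcompact.inter_right hclosed
  have hlcl : ∀ x ∈ closure T, a ≤ l x := fun x hx =>
    closure_minimal (t := {x | a ≤ l x}) hl (isClosed_le continuous_const hlc) hx
  rcases (closure T ∩ {x | ε ≤ Metric.infDist x F}).eq_empty_or_nonempty with hemp | hnon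
  · refine ⟨0, le_rfl, fun x hx => ?_⟩
    by_contra hlt
    have : x ∈ closure T ∩ {x | ε ≤ Metric.infDist x F} :=
      ⟨subset_closure hx, by simp only [mem_ofPred_eq]; linarith⟩
    rw [hemp] at this
    exact this
  -- On the compact set of points of `closure T` at distance at least `ε` from the face, `l - a` has
  -- a positive minimum; `D` is a diameter bound divided by it.
  · obtain ⟨x₀, ⟨hx₀, hx₀ε⟩, hmin⟩ := hK.exists_isMinOn hnon hlc.continuousOn
    have hδ : 0 < l x₀ - a := by
      refine sub_pos.2 (lt_of_le_of_ne (hlcl x₀ hx₀) fun h => ?_)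
      have h1 := (Metric.mem_closure_iff_infDist_zero hFne).1 (hcl x₀ hx₀ h.symm)
      have h2 : ε ≤ Metric.infDist x₀ F := hx₀ε
      linarith
    obtain ⟨w, hw⟩ := hFne
    refine ⟨2 * |M| / (l x₀ - a), by positivity, fun x hx => ?_⟩
    have hxa := sub_nonneg.2 (hl x hx)
    by_cases hxε : ε ≤ Metric.infDist x F
    · have h1 : l x₀ ≤ l x := hmin ⟨subset_closure hx, hxε⟩
      have h2 : Metric.infDist x F ≤ 2 * |M| := by
        refine (Metric.infDist_le_dist_of_mem hw).trans ?_
        rw [dist_eq_norm]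
        refine (norm_sub_le _ _).trans ?_
        linarith [hM x hx, hM w hw.1, le_abs_self M]
      have h3 : 2 * |M| ≤ 2 * |M| / (l x₀ - a) * (l x - a) := by
        rw [div_mul_eq_mul_div, le_div_iff₀ hδ]
        exact mul_le_mul_of_nonneg_left (by linarith) (by positivity)
      linarith
    · have : 0 ≤ 2 * |M| / (l x₀ - a) * (l x - a) := by positivity
      linarith

/-- Closed intervals suffice: `G` imposes on each coordinate of `v` the bounds `κ * (1 / (n + 1) +
(D n + 1) * s)` for all `n`, which tend to 0 at `s = 0`. -/
theorem exists_glue_of_bounded {C : PPClass} (hC : C.Mem (Icc (0 : ℝ) 1)) {T : Set E}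
    (hb : ∃ M, ∀ x ∈ T, ‖x‖ ≤ M) {l : E →ₗ[ℝ] ℝ} {a : ℝ}
    (hl : ∀ x ∈ T, a ≤ l x) (hne : ∃ x ∈ T, l x = a)
    (hcl : ∀ q ∈ closure T, l q = a → q ∈ closure {x ∈ T | l x = a}) :
    ∃ G : Set (E × ℝ), C.Mem G ∧ (∀ v, (v, (0 : ℝ)) ∈ G → v = 0) ∧
          ∀ x ∈ T, ∃ w ∈ T, l w = a ∧ (x - w, l x - a) ∈ G := by
  have hpos : ∀ n : ℕ, (0 : ℝ) < 1 / (n + 1 : ℝ) := fun n => by positivity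
  choose D hD0 hD using fun n => exists_modulus hb hl hne hcl (hpos n)
  let b := Module.finBasis ℝ E
  let κ : ℝ := ∑ i, ‖LinearMap.toContinuousLinearMap (b.coord i)‖
  have hκ0 : 0 ≤ κ := Finset.sum_nonneg fun i _ => norm_nonneg _
  have hκ : ∀ i v, |b.coord i v| ≤ κ * ‖v‖ := fun i v => by
    refine ((LinearMap.toContinuousLinearMap (b.coord i)).le_opNorm v).trans ?_
    refine mul_le_mul_of_nonneg_right ?_ (norm_nonneg v)
    exact Finset.single_le_sum (f := fun i => ‖LinearMap.toContinuousLinearMap (b.coord i)‖)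
      (fun i _ => norm_nonneg _) (Finset.mem_univ i)
  obtain ⟨N, hN1, hN⟩ := exists_abs_le hb l a
  -- Only bounded intervals are available, so the inequalities are capped at a value never reached
  -- on `T`.
  let B : ℕ → ℝ := fun n => 2 * (κ * (1 / (n + 1 : ℝ) + (D n + 1) * N)) + 1
  have hB : ∀ n, 0 < B n := fun n => by
    have := hD0 n
    have := hpos n
    positivity
  let G : Set (E × ℝ) := {z | ∀ p : ℕ × Fin (Module.finrank ℝ E),
    κ * (1 / (p.1 + 1 : ℝ) + (D p.1 + 1) * z.2) + b.coord p.2 z.1 ∈ Icc 0 (B p.1) ∧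
    κ * (1 / (p.1 + 1 : ℝ) + (D p.1 + 1) * z.2) - b.coord p.2 z.1 ∈ Icc 0 (B p.1)}
  refine ⟨G, Mem_forall fun p => ?_, fun v hv => ?_, fun x hx => ?_⟩
  · refine Mem.and ?_ ?_
    · refine (Mem_Icc hC (hB p.1)).of_affine ((κ * (D p.1 + 1)) • LinearMap.snd ℝ E ℝ +
        b.coord p.2 ∘ₗ LinearMap.fst ℝ E ℝ) (κ * (1 / (p.1 + 1 : ℝ))) fun z => ?_
      refine iff_of_eq (congrArg (· ∈ Icc 0 (B p.1)) ?_)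
      simp only [LinearMap.add_apply, LinearMap.smul_apply, LinearMap.comp_apply,
        LinearMap.snd_apply, LinearMap.fst_apply, smul_eq_mul]
      ring
    · refine (Mem_Icc hC (hB p.1)).of_affine ((κ * (D p.1 + 1)) • LinearMap.snd ℝ E ℝ -
        b.coord p.2 ∘ₗ LinearMap.fst ℝ E ℝ) (κ * (1 / (p.1 + 1 : ℝ))) fun z => ?_
      refine iff_of_eq (congrArg (· ∈ Icc 0 (B p.1)) ?_)
      simp only [LinearMap.sub_apply, LinearMap.smul_apply, LinearMap.comp_apply,
        LinearMap.snd_apply, LinearMap.fst_apply, smul_eq_mul]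
      ring
  · rw [← b.forall_coord_eq_zero_iff]
    intro i
    have hsmall : ∀ n : ℕ, |b.coord i v| ≤ κ * (1 / (n + 1 : ℝ)) := fun n => by
      obtain ⟨⟨h1, -⟩, h2, -⟩ := hv (n, i)
      simp only [mul_zero, add_zero] at h1 h2
      exact abs_le.2 ⟨by linarith, by linarith⟩
    have hlim0 : Tendsto (fun n : ℕ => κ * (1 / (n + 1 : ℝ))) atTop (𝓝 0) := by
      simpa using (tendsto_one_div_add_atTop_nhds_zero_nat (𝕜 := ℝ)).const_mul κ
    exact abs_nonpos_iff.1 (ge_of_tendsto' hlim0 hsmall)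
  · have hs := sub_nonneg.2 (hl x hx)
    have hsN := hN x hx
    have key : ∃ w ∈ T, l w = a ∧ ∀ n : ℕ, ‖x - w‖ ≤ 1 / (n + 1 : ℝ) + (D n + 1) * (l x - a) := by
      rcases hs.eq_or_lt with h | h
      · refine ⟨x, hx, (sub_eq_zero.1 h.symm), fun n => ?_⟩
        rw [sub_self, norm_zero, ← h, mul_zero, add_zero]
        exact (hpos n).le
      -- The distance to the face need not be attained; the `+ 1` in `D n + 1` lets one `w` serve
      -- all `n`.
      · have hlt : Metric.infDist x {x ∈ T | l x = a} <
            Metric.infDist x {x ∈ T | l x = a} + (l x - a) := lt_add_of_pos_right _ h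
        obtain ⟨w, ⟨hw, hwa⟩, hxw⟩ := (Metric.infDist_lt_iff hne).1 hlt
        refine ⟨w, hw, hwa, fun n => ?_⟩
        rw [← dist_eq_norm]
        linarith [hD n x hx]
    obtain ⟨w, hw, hwa, hxw⟩ := key
    refine ⟨w, hw, hwa, fun ⟨n, i⟩ => ?_⟩
    simp only
    have h1 := abs_le.1 ((hκ i (x - w)).trans (mul_le_mul_of_nonneg_left (hxw n) hκ0))
    have h2 : κ * (1 / (n + 1 : ℝ) + (D n + 1) * (l x - a)) ≤
        κ * (1 / (n + 1 : ℝ) + (D n + 1) * N) := by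
      have := hD0 n
      gcongr
    exact ⟨⟨by linarith, by simp only [B]; linarith⟩, by linarith, by simp only [B]; linarith⟩

end

section Bounded

variable {E : Type} [NormedAddCommGroup E] [NormedSpace ℝ E] [FiniteDimensional ℝ E]

theorem pinchedSquare_yields_of_bounded {T : Set E} (hT : Convex ℝ T)
    (hb : ∃ M, ∀ x ∈ T, ‖x‖ ≤ M) : Yields pinchedSquare T := by
  intro C hC
  have hQ : ∀ M : ℝ, C.Mem {z : ℝ × ℝ | (M⁻¹ * z.1, M⁻¹ * z.2) ∈ pinchedSquare} := fun M =>
    hC.of_affine ((M⁻¹ • LinearMap.fst ℝ ℝ ℝ).prod (M⁻¹ • LinearMap.snd ℝ ℝ ℝ)) 0 fun x => by simp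
  have hQ0 : ∀ M : ℝ, 1 ≤ M → ∀ s, (s, (0 : ℝ)) ∈
      {z : ℝ × ℝ | (M⁻¹ * z.1, M⁻¹ * z.2) ∈ pinchedSquare} ↔ s = 0 := fun M hM s => by
    have hM0 : M ≠ 0 := by linarith
    simp only [pinchedSquare, mem_ofPred_eq, mul_zero, le_refl, zero_le_one, true_and,
      true_implies, mul_eq_zero, inv_eq_zero, hM0, false_or, and_iff_right_iff_imp]
    rintro rfl
    simp
  have key : ∀ M : ℝ, 1 ≤ M → ∀ y, 0 < y → y ≤ M → ∀ s, |s| ≤ M →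
      (s, y) ∈ {z : ℝ × ℝ | (M⁻¹ * z.1, M⁻¹ * z.2) ∈ pinchedSquare} := fun M hM y hy hyM s hs => by
    have hM0 : 0 < M := by linarith
    have : 0 < M⁻¹ * y := by positivity
    refine ⟨this.le, ?_, ?_, fun h => absurd h this.ne'⟩
    · show M⁻¹ * y ≤ 1
      rwa [inv_mul_le_iff₀ hM0, mul_one]
    · show |M⁻¹ * s| ≤ 1
      rwa [abs_mul, abs_of_pos (inv_pos.2 hM0), inv_mul_le_iff₀ hM0, mul_one]
  refine Mem_of_glue (fun E _ _ _ T => Convex ℝ T ∧ ∃ M, ∀ x ∈ T, ‖x‖ ≤ M)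
    (fun E _ _ _ T h => h.1)
    (fun E _ _ _ T h l p => ⟨convex_section h.1 _ p, bounded_section h.2 _ p⟩) ?_ ?_ ⟨hT, hb⟩
  · intro E _ _ _ T hT l a hl
    obtain ⟨M, hM, hTM⟩ := exists_abs_le hT.2 l a
    exact exists_separating_of_planar (hQ M) (hQ0 M hM) fun x hx =>
      key M hM _ (sub_pos.2 (hl x hx)) (hTM x hx).le _ (by simpa using hM)
  · intro E _ _ _ T hT l a hl hne
    obtain ⟨M, hM, hTM⟩ := exists_abs_le hT.2 l a
    choose N hN1 hN using fun i => exists_abs_le hT.2 ((Module.finBasis ℝ E).coord i) 0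
    choose N' hN1' hN' using fun i => exists_abs_le hT.2 (-(Module.finBasis ℝ E).coord i) 0
    let B := M + ∑ i, (N i + N' i)
    have hsum : ∀ i, N i + N' i ≤ ∑ i, (N i + N' i) := fun i =>
      Finset.single_le_sum (f := fun i => N i + N' i)
        (fun i _ => by linarith [hN1 i, hN1' i]) (Finset.mem_univ i)
    have hsum0 : 0 ≤ ∑ i, (N i + N' i) :=
      Finset.sum_nonneg fun i _ => by linarith [hN1 i, hN1' i]
    have hB : 1 ≤ B := by simp only [B]; linarith
    refine exists_glue_of_planar (hQ B) (hQ0 B hB) (fun x hx h w hw i => key B hB _ (sub_pos.2 h)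
      (by simp only [B]; linarith [hTM x hx]) _ ?_) hl hne
    have h1 := hN i x hx
    have h2 := hN' i x hx
    have h3 := hN i w hw
    have h4 := hN' i w hw
    have h5 := hsum i
    simp only [LinearMap.neg_apply, sub_zero] at h1 h2 h3 h4
    rw [map_sub, abs_le]
    simp only [B]
    constructor <;> linarith

/-- Open intervals handle disjoint hyperplanes; for touching ones `mem_closure_face` makes gluing by
closed intervals possible. -/
theorem Ioo_yields_of_bounded {T : Set E} (hT : Convex ℝ T) (hb : ∃ M, ∀ x ∈ T, ‖x‖ ≤ M)
    (h : ¬ Yields T pinchedSquare) : Yields (Ioo (0 : ℝ) 1) T := by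
  intro C hC
  have hIcc := Ioo_yields_Icc C hC
  refine Mem_of_glue (fun E _ _ _ T => Convex ℝ T ∧ (∃ M, ∀ x ∈ T, ‖x‖ ≤ M) ∧
    ¬ Yields T pinchedSquare) (fun E _ _ _ T h => h.1)
    (fun E _ _ _ T h l p => ⟨convex_section h.1 _ p, bounded_section h.2.1 _ p,
      not_yields_section h.2.2 _ p⟩) ?_ ?_ ⟨hT, hb, h⟩
  · rintro E _ _ _ T ⟨-, hb, -⟩ l a hl
    obtain ⟨M, hM, hTM⟩ := exists_abs_le hb l a
    exact ⟨Ioo a (a + M), Mem_Ioo hC (by linarith), by simp,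
      fun x hx => ⟨hl x hx, by linarith [hTM x hx]⟩⟩
  · rintro E _ _ _ T ⟨hT, hb, h⟩ l a hl hne
    exact exists_glue_of_bounded hIcc hb hl hne fun q hq hqa => mem_closure_face hT h hl hne hq hqa

/-- Functionals now attain their minimum on nonempty `T`, as an unattained one would yield `Ioo 0
1`; so closed intervals also handle disjoint hyperplanes. -/
theorem Icc_yields_of_bounded {T : Set E} (hT : Convex ℝ T) (hb : ∃ M, ∀ x ∈ T, ‖x‖ ≤ M)
    (h : ¬ Yields T (Ioo (0 : ℝ) 1)) : Yields (Icc (0 : ℝ) 1) T := by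
  intro C hC
  refine Mem_of_glue (fun E _ _ _ T => Convex ℝ T ∧ (∃ M, ∀ x ∈ T, ‖x‖ ≤ M) ∧
    ¬ Yields T (Ioo (0 : ℝ) 1)) (fun E _ _ _ T h => h.1)
    (fun E _ _ _ T h l p => ⟨convex_section h.1 _ p, bounded_section h.2.1 _ p,
      not_yields_section h.2.2 _ p⟩) ?_ ?_ ⟨hT, hb, h⟩
  · rintro E _ _ _ T ⟨hT, hb, h⟩ l a hl
    rcases T.eq_empty_or_nonempty with rfl | hne
    · exact ⟨∅, Mem_empty, by simp, by simp⟩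
    obtain ⟨M, hM, hTM⟩ := exists_abs_le hb l a
    have hmin : ∃ x ∈ T, ∀ y ∈ T, l x ≤ l y := by
      by_contra hno
      push Not at hno
      refine h ((yields_image T l).trans (yields_Ioo (hT.linear_image l) (hne.image l) (a := a)
        ?_ ?_))
      · rintro _ ⟨x, hx, rfl⟩
        exact (hl x hx).le
      · rintro _ ⟨x, hx, rfl⟩
        obtain ⟨y, hy, hyx⟩ := hno x hx
        exact ⟨l y, mem_image_of_mem l hy, hyx⟩
    obtain ⟨x₀, hx₀, hmin⟩ := hmin
    exact ⟨Icc (l x₀) (a + M), Mem_Icc hC (by linarith [hTM x₀ hx₀]),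
      fun h' => absurd (hl x₀ hx₀) (not_lt.2 h'.1),
      fun x hx => ⟨hmin x hx, by linarith [hTM x hx]⟩⟩
  · rintro E _ _ _ T ⟨hT, hb, h⟩ l a hl hne
    exact exists_glue_of_bounded hC hb hl hne fun q hq hqa =>
      mem_closure_face hT (fun h' => h (h'.trans pinchedSquare_yields_Ioo)) hl hne hq hqa

/-- Reduction of definability of a convex set to the bounded case. -/
theorem yields_of_bounded_case {F G : Type*} [AddCommGroup F] [Module ℝ F] [AddCommGroup G]
    [Module ℝ G] {R : Set F} {R' : Set G} (hR' : Yields pinchedStrip R')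
    (hbdd : ∀ (k : ℕ) (T : Set (Fin k → ℝ)), Convex ℝ T → (∃ M, ∀ x ∈ T, ‖x‖ ≤ M) →
      ¬ Yields T R' → Yields R T)
    {T : Set E} (hT : Convex ℝ T) (h : ¬ Yields T R') : Yields R T := by
  obtain ⟨k, π, ⟨M, hM⟩, hπ⟩ := exists_bounded_projection hT fun h' => h (h'.trans hR')
  refine Yields.trans (hbdd k (π '' T) (hT.linear_image π) ⟨M, ?_⟩ fun h' =>
    h ((yields_image T π).trans h')) fun C hC => hC.of_affine π 0 fun x => ?_
  · rintro _ ⟨x, hx, rfl⟩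
    exact hM x hx
  · rw [add_zero]
    exact hπ x

theorem pinchedSquare_yields_of_not_yields_pinchedStrip {T : Set E} (hT : Convex ℝ T)
    (h : ¬ Yields T pinchedStrip) : Yields pinchedSquare T :=
  yields_of_bounded_case (fun _ hC => hC)
    (fun _ _ hT hb _ => pinchedSquare_yields_of_bounded hT hb) hT h

theorem Ioo_yields_of_not_yields_pinchedSquare {T : Set E} (hT : Convex ℝ T)
    (h : ¬ Yields T pinchedSquare) : Yields (Ioo (0 : ℝ) 1) T :=
  yields_of_bounded_case pinchedStrip_yields_pinchedSquare
    (fun _ _ hT hb h => Ioo_yields_of_bounded hT hb h) hT h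

theorem Icc_yields_of_not_yields_Ioo {T : Set E} (hT : Convex ℝ T)
    (h : ¬ Yields T (Ioo (0 : ℝ) 1)) : Yields (Icc (0 : ℝ) 1) T :=
  yields_of_bounded_case (pinchedStrip_yields_pinchedSquare.trans pinchedSquare_yields_Ioo)
    (fun _ _ hT hb h => Icc_yields_of_bounded hT hb h) hT h

end Bounded

end InfPP

/-! ### Functionals separating neighbours in the chain. -/

namespace InfPP

open Set PPClass Filter Topology

section

variable {ι : Type*} {f : (ι → ℝ) →ₗ[ℝ] ℝ} {hf : f (fun _ => 1) = 1}

theorem invClass_Mem_real {s : Set ℝ} :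
    (invClass f hf).Mem s ↔ ∀ y : ι → ℝ, (∀ i, y i ∈ s) → f y ∈ s := by
  constructor
  · intro h y hy
    have := h 1 (LinearMap.proj 0) 0 (fun i _ => y i) (fun i => by simpa using hy i)
    simpa [applyCoord] using this
  · intro h k g e x hx
    rw [mem_ofPred_eq, linearMap_applyCoord f hf g e x]
    exact h _ hx

theorem invClass_Mem_prod {s : Set (ℝ × ℝ)} :
    (invClass f hf).Mem s ↔ ∀ y z : ι → ℝ, (∀ i, (y i, z i) ∈ s) → (f y, f z) ∈ s := by
  constructor
  · intro h y z hyz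
    have := h 2 ((LinearMap.proj 0).prod (LinearMap.proj 1)) 0 (fun i => ![y i, z i])
      (fun i => by simpa using hyz i)
    simpa [applyCoord] using this
  · intro h k g e x hx
    have h1 := linearMap_applyCoord f hf (LinearMap.fst ℝ ℝ ℝ ∘ₗ g) e.1 x
    have h2 := linearMap_applyCoord f hf (LinearMap.snd ℝ ℝ ℝ ∘ₗ g) e.2 x
    have : g (applyCoord f x) + e = (f (fun i => (g (x i) + e).1), f (fun i => (g (x i) + e).2)) :=
      Prod.ext h1 h2
    rw [mem_ofPred_eq, this]
    exact h _ _ hx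

end

/-- The bounded sequences. -/
def boundedSeq : Submodule ℝ (ℕ → ℝ) where
  carrier := {x | ∃ M, ∀ n, |x n| ≤ M}
  zero_mem' := ⟨0, by simp⟩
  add_mem' := by
    rintro x y ⟨M, h⟩ ⟨M', h'⟩
    exact ⟨M + M', fun n => (abs_add_le _ _).trans (add_le_add (h n) (h' n))⟩
  smul_mem' := by
    rintro r x ⟨M, h⟩
    refine ⟨|r| * M, fun n => ?_⟩
    rw [Pi.smul_apply, smul_eq_mul, abs_mul]
    exact mul_le_mul_of_nonneg_left (h n) (abs_nonneg r)

theorem one_mem_boundedSeq : (fun _ => 1) ∈ boundedSeq := ⟨1, by simp⟩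

theorem mem_boundedSeq_of_Icc {x : ℕ → ℝ} (hx : ∀ n, x n ∈ Icc (0 : ℝ) 1) : x ∈ boundedSeq :=
  ⟨1, fun n => abs_le.2 ⟨by linarith [(hx n).1], (hx n).2⟩⟩

/-- Functionals on bounded sequences extend to all sequences with a prescribed value at a given
unbounded sequence. -/
theorem exists_extension (g : boundedSeq →ₗ[ℝ] ℝ) {y : ℕ → ℝ} (hy : y ∉ boundedSeq) (c : ℝ) :
    ∃ f : (ℕ → ℝ) →ₗ[ℝ] ℝ, (∀ x (hx : x ∈ boundedSeq), f x = g ⟨x, hx⟩) ∧ f y = c := by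
  obtain ⟨f, hf⟩ := LinearMap.exists_extend g
  -- Adding a multiple of `φ`, which kills bounded sequences but not `y`, adjusts the value at `y`
  -- alone.
  obtain ⟨φ, hφy, hφ⟩ := Submodule.exists_le_ker_of_notMem hy
  refine ⟨f + ((c - f y) / φ y) • φ, fun x hx => ?_, ?_⟩
  · have h1 : φ x = 0 := hφ hx
    have h2 : f x = g ⟨x, hx⟩ := LinearMap.congr_fun hf ⟨x, hx⟩
    simp [h1, h2]
  · simp [div_mul_cancel₀ _ hφy]

theorem natCast_notMem_boundedSeq : (fun n : ℕ => (n : ℝ)) ∉ boundedSeq := by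
  rintro ⟨M, hM⟩
  obtain ⟨n, hn⟩ := exists_nat_gt M
  exact absurd (hM n) (not_le.2 (hn.trans_le (le_abs_self _)))

/-- A linear functional on all sequences that is a limit along an ultrafilter on bounded ones. -/
theorem exists_limit_functional : ∃ f : (ℕ → ℝ) →ₗ[ℝ] ℝ, ∀ x ∈ boundedSeq,
    Tendsto x (hyperfilter ℕ) (𝓝 (f x)) := by
  have h : ∀ x : boundedSeq, ∃ a, Tendsto x.1 (hyperfilter ℕ) (𝓝 a) := by
    rintro ⟨x, M, hM⟩
    obtain ⟨a, -, ha⟩ := (isCompact_Icc (a := -M) (b := M)).ultrafilter_le_nhds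
      ((hyperfilter ℕ).map x) (by
        rw [le_principal_iff]
        exact Filter.Eventually.of_forall (f := (hyperfilter ℕ : Filter ℕ))
          fun n => abs_le.1 (hM n))
    exact ⟨a, ha⟩
  choose L hL using h
  let g : boundedSeq →ₗ[ℝ] ℝ :=
    { toFun := L
      map_add' := fun x y => tendsto_nhds_unique (hL (x + y)) ((hL x).add (hL y))
      map_smul' := fun r x => tendsto_nhds_unique (hL (r • x)) ((hL x).const_mul r) }
  obtain ⟨f, hf, -⟩ := exists_extension g natCast_notMem_boundedSeq 0
  exact ⟨f, fun x hx => by rw [hf x hx]; exact hL ⟨x, hx⟩⟩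

theorem limit_eq {f : (ℕ → ℝ) →ₗ[ℝ] ℝ}
    (hf : ∀ x ∈ boundedSeq, Tendsto x (hyperfilter ℕ) (𝓝 (f x))) {x : ℕ → ℝ} (hx : x ∈ boundedSeq)
    {a : ℝ} (h : Tendsto x atTop (𝓝 a)) : f x = a :=
  tendsto_nhds_unique (hf x hx) (h.mono_left Nat.hyperfilter_le_atTop)

theorem limit_mem_Icc {f : (ℕ → ℝ) →ₗ[ℝ] ℝ}
    (hf : ∀ x ∈ boundedSeq, Tendsto x (hyperfilter ℕ) (𝓝 (f x))) {x : ℕ → ℝ}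
    (hx : ∀ n, x n ∈ Icc (0 : ℝ) 1) : f x ∈ Icc (0 : ℝ) 1 :=
  isClosed_Icc.mem_of_tendsto (hf x (mem_boundedSeq_of_Icc hx)) (Eventually.of_forall hx)

/-- Some linear functional of countable arity that fixes the constants preserves `R` but
not `R'`. -/
def Separated {E F : Type*} [AddCommGroup E] [Module ℝ E] [AddCommGroup F] [Module ℝ F]
    (R : Set E) (R' : Set F) : Prop :=
  ∃ (f : (ℕ → ℝ) →ₗ[ℝ] ℝ) (hf : f (fun _ => 1) = 1),
    (invClass f hf).Mem R ∧ ¬ (invClass f hf).Mem R'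

theorem separated_univ_Icc : Separated (univ : Set ℝ) (Icc (0 : ℝ) 1) := by
  refine ⟨(2 : ℝ) • LinearMap.proj 0 - LinearMap.proj 1, by norm_num, Mem_univ, fun h => ?_⟩
  rw [invClass_Mem_real] at h
  have := h (fun n => if n = 0 then 1 else 0) fun n => by
    by_cases hn : n = 0 <;> simp [hn]
  norm_num at this

/-- An ultrafilter limit respects closed intervals but sends `1 / (n + 2)` to 0. -/
theorem separated_Icc_Ioo : Separated (Icc (0 : ℝ) 1) (Ioo (0 : ℝ) 1) := by
  obtain ⟨f, hf⟩ := exists_limit_functional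
  refine ⟨f, limit_eq hf one_mem_boundedSeq tendsto_const_nhds,
    invClass_Mem_real.2 fun y hy => limit_mem_Icc hf hy, fun h => ?_⟩
  rw [invClass_Mem_real] at h
  have hx : ∀ n : ℕ, 1 / ((n : ℝ) + 1 + 1) ∈ Ioo (0 : ℝ) 1 := fun n => by
    refine ⟨by positivity, ?_⟩
    rw [div_lt_one (by positivity)]
    have : (0 : ℝ) ≤ n := n.cast_nonneg
    linarith
  have h0 : Tendsto (fun n : ℕ => 1 / ((n : ℝ) + 1 + 1)) atTop (𝓝 0) := by
    have := (tendsto_add_atTop_iff_nat 1).2 (tendsto_one_div_add_atTop_nhds_zero_nat (𝕜 := ℝ))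
    simpa using this
  have h1 := limit_eq hf (mem_boundedSeq_of_Icc fun n => Ioo_subset_Icc_self (hx n)) h0
  have h2 := h _ hx
  rw [h1] at h2
  exact lt_irrefl _ h2.1

/-- Averaging a limit with coordinate 0 keeps values strictly inside. Heights `0, 1/2, 1/3, …` still
average to 0, while abscissae `0, 1, 1, …` average to `1 / 2`. -/
theorem separated_Ioo_pinchedSquare : Separated (Ioo (0 : ℝ) 1) pinchedSquare := by
  obtain ⟨f, hf⟩ := exists_limit_functional
  refine ⟨(1 / 2 : ℝ) • LinearMap.proj 0 + (1 / 2 : ℝ) • f, ?_, invClass_Mem_real.2 fun y hy => ?_,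
    fun h => ?_⟩
  · have := limit_eq hf one_mem_boundedSeq tendsto_const_nhds
    simp only [LinearMap.add_apply, LinearMap.smul_apply, LinearMap.proj_apply, this, smul_eq_mul]
    norm_num
  · have h1 := limit_mem_Icc hf fun n => Ioo_subset_Icc_self (hy n)
    have h2 := hy 0
    simp only [LinearMap.add_apply, LinearMap.smul_apply, LinearMap.proj_apply, smul_eq_mul]
    constructor <;> linarith [h1.1, h1.2, h2.1, h2.2]
  · rw [invClass_Mem_prod] at h
    have hx1 : (fun n : ℕ => if n = 0 then (0 : ℝ) else 1) ∈ boundedSeq := ⟨1, fun n => by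
      by_cases hn : n = 0 <;> simp [hn]⟩
    have hy1 : ∀ n : ℕ, (if n = 0 then (0 : ℝ) else 1 / (n + 1 : ℝ)) ∈ Icc (0 : ℝ) 1 := fun n => by
      by_cases hn : n = 0
      · simp [hn]
      · rw [if_neg hn]
        refine ⟨by positivity, ?_⟩
        rw [div_le_one (by positivity)]
        linarith [(n.cast_nonneg : (0 : ℝ) ≤ n)]
    have hx2 : f (fun n : ℕ => if n = 0 then (0 : ℝ) else 1) = 1 :=
      limit_eq hf hx1 (tendsto_const_nhds.congr' (by
        filter_upwards [eventually_ne_atTop 0] with n hn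
        simp [hn]))
    have hy2 : f (fun n : ℕ => if n = 0 then (0 : ℝ) else 1 / (n + 1 : ℝ)) = 0 :=
      limit_eq hf (mem_boundedSeq_of_Icc hy1) (tendsto_one_div_add_atTop_nhds_zero_nat.congr' (by
        filter_upwards [eventually_ne_atTop 0] with n hn
        simp [hn]))
    have := h (fun n => if n = 0 then (0 : ℝ) else 1)
      (fun n => if n = 0 then (0 : ℝ) else 1 / (n + 1 : ℝ)) fun n => by
        refine ⟨(hy1 n).1, (hy1 n).2, ?_, ?_⟩
        · by_cases hn : n = 0 <;> simp [hn]
        · by_cases hn : n = 0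
          · simp [hn]
          · intro h'
            simp only [hn, if_false] at h'
            have : (0 : ℝ) < 1 / (n + 1 : ℝ) := by positivity
            exact absurd h' this.ne'
    have h3 := this.2.2.2
    simp only [LinearMap.add_apply, LinearMap.smul_apply, LinearMap.proj_apply, hx2, hy2] at h3
    norm_num at h3

/-- The functional is coordinate 0 on bounded sequences, all that the square sees. In the strip the
abscissae may be `n`, which it sends to 1 over height 0. -/
theorem separated_pinchedSquare_pinchedStrip : Separated pinchedSquare pinchedStrip := by
  obtain ⟨f, hf, hfn⟩ := exists_extension (LinearMap.proj 0 ∘ₗ boundedSeq.subtype)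
    natCast_notMem_boundedSeq 1
  have hf' : ∀ x ∈ boundedSeq, f x = x 0 := fun x hx => hf x hx
  refine ⟨f, hf' _ one_mem_boundedSeq, invClass_Mem_prod.2 fun y z hyz => ?_, fun h => ?_⟩
  · rw [hf' y ⟨1, fun n => (hyz n).2.2.1⟩,
      hf' z (mem_boundedSeq_of_Icc fun n => ⟨(hyz n).1, (hyz n).2.1⟩)]
    exact hyz 0
  · rw [invClass_Mem_prod] at h
    have hy : ∀ n : ℕ, (if n = 0 then (0 : ℝ) else 1) ∈ Icc (0 : ℝ) 1 := fun n => by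
      by_cases hn : n = 0 <;> simp [hn]
    have h1 := h (fun n => n) (fun n => if n = 0 then (0 : ℝ) else 1) fun n => by
      refine ⟨(hy n).1, (hy n).2, ?_⟩
      by_cases hn : n = 0 <;> simp [hn]
    have h2 := h1.2.2
    simp only [hfn, hf' _ (mem_boundedSeq_of_Icc hy), if_true] at h2
    exact one_ne_zero (h2 trivial)

theorem summable_of_mem_boundedSeq {x : ℕ → ℝ} (hx : x ∈ boundedSeq) :
    Summable fun n => x n * (1 / 2 / 2 ^ n : ℝ) := by
  obtain ⟨M, hM⟩ := hx
  refine Summable.of_norm_bounded ((summable_geometric_two' 1).mul_left M) fun n => ?_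
  rw [norm_mul, Real.norm_of_nonneg (by positivity : (0 : ℝ) ≤ 1 / 2 / 2 ^ n)]
  exact mul_le_mul_of_nonneg_right (hM n) (by positivity)

/-- With strictly positive weights on bounded sequences, total height 0 forces all heights, hence
all abscissae, to vanish. The unbounded sequence `n` may still be sent to `-1`. -/
theorem separated_pinchedStrip_Ici : Separated pinchedStrip (Ici (0 : ℝ)) := by
  let g : boundedSeq →ₗ[ℝ] ℝ :=
    { toFun := fun x => ∑' n, x.1 n * (1 / 2 / 2 ^ n : ℝ)
      map_add' := fun x y => by
        rw [← (summable_of_mem_boundedSeq x.2).tsum_add (summable_of_mem_boundedSeq y.2)]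
        exact tsum_congr fun n => add_mul _ _ _
      map_smul' := fun r x => by
        rw [RingHom.id_apply, smul_eq_mul, ← tsum_mul_left]
        exact tsum_congr fun n => mul_assoc _ _ _ }
  obtain ⟨f, hf, hfn⟩ := exists_extension g natCast_notMem_boundedSeq (-1)
  have hf' : ∀ x ∈ boundedSeq, f x = ∑' n, x n * (1 / 2 / 2 ^ n : ℝ) := fun x hx => hf x hx
  have hone : f (fun _ => 1) = 1 := by
    rw [hf' _ one_mem_boundedSeq]
    simp only [one_mul]
    exact tsum_geometric_two' 1
  refine ⟨f, hone, invClass_Mem_prod.2 fun y z hyz => ?_, fun h => ?_⟩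
  · have hz : ∀ n, z n ∈ Icc (0 : ℝ) 1 := fun n => ⟨(hyz n).1, (hyz n).2.1⟩
    have hzb := mem_boundedSeq_of_Icc hz
    have hnn : ∀ n, 0 ≤ z n * (1 / 2 / 2 ^ n : ℝ) := fun n =>
      mul_nonneg (hz n).1 (by positivity)
    refine ⟨?_, ?_, fun h0 => ?_⟩
    · show 0 ≤ f z
      rw [hf' z hzb]
      exact tsum_nonneg hnn
    · show f z ≤ 1
      refine le_trans ?_ hone.le
      rw [hf' z hzb, hf' _ one_mem_boundedSeq]
      exact (summable_of_mem_boundedSeq hzb).tsum_le_tsum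
        (fun n => mul_le_mul_of_nonneg_right (hz n).2 (by positivity))
        (summable_of_mem_boundedSeq one_mem_boundedSeq)
    · change f z = 0 at h0
      rw [hf' z hzb] at h0
      have hzero := (summable_of_mem_boundedSeq hzb).hasSum
      rw [h0, hasSum_zero_iff_of_nonneg hnn] at hzero
      have hy : y = 0 := by
        funext n
        have h1 := congrFun hzero n
        have h2 : (1 / 2 / 2 ^ n : ℝ) ≠ 0 := by positivity
        simp only [Pi.zero_apply] at h1
        exact (hyz n).2.2 ((mul_eq_zero.1 h1).resolve_right h2)
      show f y = 0
      rw [hy, map_zero]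
  · rw [invClass_Mem_real] at h
    have := h (fun n => n) fun n => mem_Ici.2 n.cast_nonneg
    rw [hfn] at this
    norm_num at this

/-! ### Assembling the levels. -/

/-- The comparison step between two consecutive levels of definability. -/
theorem isInfPPDefinable_of_separated {E F : Type*} [AddCommGroup E] [Module ℝ E]
    [AddCommGroup F] [Module ℝ F] {R : Set E} {R' : Set F} (hsep : Separated R R')
    (hle : ∀ {k : ℕ} {T : Set (Fin k → ℝ)}, Convex ℝ T → ¬ Yields T R' → Yields R T)
    {n m : ℕ} {S : Set (Fin n → ℝ)} {T : Set (Fin m → ℝ)} (hS : Convex ℝ S) (hT : Convex ℝ T)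
    (hSR : Yields S R) (hSR' : ¬ Yields S R')
    (hinv : ∀ f : (ℕ → ℝ) → ℝ, IsPolymorphism (realLang S) f → Preserves f T) :
    IsInfPPDefinable (realLang S) T := by
  obtain ⟨f, hf, hR, hR'⟩ := hsep
  have hSf : (invClass f hf).Mem S := hle hS hSR' _ hR
  have hTf : (invClass f hf).Mem T :=
    Mem_iff_mem.2 (hinv f (isPolymorphism_of_linearMap f hf (Mem_iff_mem.1 hSf)))
  have hTR' : ¬ Yields T R' := fun h => hR' (h _ hTf)
  exact Mem_iff_mem.1 ((hSR.trans (hle hT hTR')) (defClass S) (Mem_iff_mem.2 (defClass_mem_self S)))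

/-- Invariance under polymorphisms of arity two yields convexity. -/
theorem convex_of_invariant {n m : ℕ} {S : Set (Fin n → ℝ)} {T : Set (Fin m → ℝ)}
    (hS : Convex ℝ S)
    (hinv : ∀ f : (Bool → ℝ) → ℝ, IsPolymorphism (realLang S) f → Preserves f T) :
    Convex ℝ T := by
  intro x hx y hy a b ha hb hab
  let f : (Bool → ℝ) →ₗ[ℝ] ℝ := a • LinearMap.proj true + b • LinearMap.proj false
  have happ : ∀ (k : ℕ) (z : Bool → Fin k → ℝ), applyCoord f z = a • z true + b • z false :=
    fun k z => funext fun j => by simp [applyCoord, f]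
  have hpol : IsPolymorphism (realLang S) f :=
    isPolymorphism_of_linearMap f (by simp [f, hab]) fun z hz => by
      rw [happ]
      exact hS (hz true) (hz false) ha hb hab
  have := hinv f hpol (fun i => bif i then x else y) fun i => by cases i <;> assumption
  rw [happ] at this
  exact this

end InfPP

theorem corollary6p6 {n : ℕ} (S : Set (Fin n → ℝ)) (hS : Convex ℝ S)
    {m : ℕ} (T : Set (Fin m → ℝ)) :
    InfPP.IsInfPPDefinable (InfPP.realLang S) T ↔
      ∀ (ι : Type) [Countable ι] (f : (ι → ℝ) → ℝ),
        InfPP.IsPolymorphism (InfPP.realLang S) f → InfPP.Preserves f T := by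
  open InfPP in
  refine ⟨fun h ι _ f hf => h.preserves hf, fun h => ?_⟩
  have hT := convex_of_invariant hS (h Bool)
  by_cases h1 : Yields S (Set.Icc (0 : ℝ) 1)
  swap
  · exact isInfPPDefinable_of_separated separated_univ_Icc yields_of_not_yields_Icc hS hT
      (fun _ _ => PPClass.Mem_univ) h1 (h ℕ)
  by_cases h2 : Yields S (Set.Ioo (0 : ℝ) 1)
  swap
  · exact isInfPPDefinable_of_separated separated_Icc_Ioo Icc_yields_of_not_yields_Ioo hS hT
      h1 h2 (h ℕ)
  by_cases h3 : Yields S pinchedSquare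
  swap
  · exact isInfPPDefinable_of_separated separated_Ioo_pinchedSquare
      Ioo_yields_of_not_yields_pinchedSquare hS hT h2 h3 (h ℕ)
  by_cases h4 : Yields S pinchedStrip
  swap
  · exact isInfPPDefinable_of_separated separated_pinchedSquare_pinchedStrip
      pinchedSquare_yields_of_not_yields_pinchedStrip hS hT h3 h4 (h ℕ)
  by_cases h5 : Yields S (Set.Ici (0 : ℝ))
  swap
  · exact isInfPPDefinable_of_separated separated_pinchedStrip_Ici
      pinchedStrip_yields_of_not_yields_Ici hS hT h4 h5 (h ℕ)
  exact PPClass.Mem_iff_mem.1 ((h5.trans (Ici_yields_of_convex hT)) (defClass S)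
    (PPClass.Mem_iff_mem.2 (defClass_mem_self S)))
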